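/- Consider a memoryless channel with three inputs $X_i\in\mathcal X_i$ and three outputs $Y_i\in\mathcal Y_i$ ($i=1,2,3$), where all alphabets are standard Borel spaces (for instance finite sets, or $\mathbb R^d$, $\mathbb C^d$), given by a transition probability kernel $P(Y_1,Y_2,Y_3\mid X_1,X_2,X_3)$. In the 3-user cognitive interference channel with cognitive-only message sharing (3-CIFC-CoMS), a code of block length $N$ with rates $R_1,R_2,R_3\ge 0$ has independent messages $W_i$, uniform on $\{1,\dots,\lfloor 2^{NR_i}\rfloor\}$; encoders $X_1^N=f_1(W_1)$ and $X_2^N=f_2(W_2)$ for the two primary users and $X_3^N=f_3(W_1,W_2,W_3)$ for the cognitive user; and (measurable) decoders $\widehat W_i=g_i(Y_i^N)$. The capacity region $\mathcal C$ is the set of all triples $(R_1,R_2,R_3)$ with nonnegative entries for which there is a sequence of such codes, indexed by $N$, with $\max_i\mathbb P[\widehat W_i\ne W_i]\to0$ as $N\to\infty$. For a probability distribution $P=P_{X_1,X_2,X_3}$ on $\mathcal X_1\times\mathcal X_2\times\mathcal X_3$ let $\mathcal R(P)$ be the set of triples $(R_1,R_2,R_3)$ with $$\begin{aligned} R_1&\le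 I(Y_1;X_1,X_3\mid X_2),\\ R_2&\le I(Y_2;X_2,X_3\mid X_1),\\ R_3&\le I(Y_3;X_3\mid X_1,X_2),\\ R_1+R_3&\le I(Y_1;X_1,X_3\mid X_2)+I(Y_3;X_3\mid X_2,X_1,Y_1),\\ R_2+R_3&\le I(Y_2;X_2,X_3\mid X_1)+I(Y_3;X_3\mid X_1,X_2,Y_2),\\ R_1+R_2+R_3&\le I(Y_1;X_1,X_2,X_3)+I(Y_2;X_2,X_3\mid X_1,Y_1)+I(Y_3;X_3\mid X_1,Y_1,X_2,Y_2),\\ R_2+R_1+R_3&\le I(Y_2;X_2,X_1,X_3)+I(Y_1;X_1,X_3\mid X_2,Y_2)+I(Y_3;X_3\mid X_2,Y_2,X_1,Y_1), \end{aligned}$$ where the mutual informations (in bits, possibly $+\infty$) are computed for inputs distributed according to $P$ and outputs given by the channel. Then $\mathcal C$ is contained in the closure of $\bigcup_P\mathcal R(P)$. If moreover the input alphabets $\mathcal X_1,\mathcal X_2,\mathcal X_3$ are finite, then $\mathcal C\subseteq\bigcup_P\mathcal R(P)$, that is, every triple in the capacity region satisfies the seven bounds for some joint input distribution $P_{X_1,X_2,X_3}$.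 -/

import Mathlib

open MeasureTheory ProbabilityTheory InformationTheory Filter
open scoped ENNReal Topology

noncomputable section

namespace CIFC

universe u v

/-- The mutual information `I(Y; X)` in bits under the law `μ`, namely the Kullback-Leibler
divergence of the joint law from the product of the marginals (`∞` is allowed). -/
def mutualInfo {Ω α β : Type*} [MeasurableSpace Ω] [MeasurableSpace α] [MeasurableSpace β]
    (μ : Measure Ω) (Y : Ω → α) (X : Ω → β) : ℝ≥0∞ :=
  klDiv (μ.map fun ω => (X ω, Y ω)) ((μ.map X).prod (μ.map Y)) / ENNReal.ofReal (Real.log 2)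

/-- The conditional mutual information `I(Y; X | Z)` in bits under the law `μ`, namely the
Kullback-Leibler divergence of the joint law `P_{Z,X,Y}` from `P_{Z,X} ⊗ P_{Y|Z}`, the law with the
same `(Z, X)`- and `(Z, Y)`-marginals that makes `X` and `Y` conditionally independent given `Z`. -/
def condMutualInfo {Ω α β γ : Type*} [MeasurableSpace Ω] [MeasurableSpace α]
    [StandardBorelSpace α] [Nonempty α] [MeasurableSpace β] [MeasurableSpace γ]
    (μ : Measure Ω) [IsFiniteMeasure μ] (Y : Ω → α) (X : Ω → β) (Z : Ω → γ) : ℝ≥0∞ :=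
  klDiv (μ.map fun ω => ((Z ω, X ω), Y ω))
      ((μ.map fun ω => (Z ω, X ω)) ⊗ₘ (condDistrib Y Z μ).prodMkRight β)
    / ENNReal.ofReal (Real.log 2)

/-- The number of messages `⌊2 ^ (N r)⌋` at rate `r` (bits per channel use) and block length `N`. -/
def numMsg (N : ℕ) (r : ℝ) : ℕ := ⌊(2 : ℝ) ^ ((N : ℝ) * r)⌋₊

/-- Message triples `(W₁, W₂, W₃)`. The users `1, 2, 3` carry the indices `0, 1, 2`. -/
abbrev Msg (N : ℕ) (R : Fin 3 → ℝ) : Type := ∀ i, Fin (numMsg N (R i))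

/-- A block code with rate vector `R` and block length `N` for three users with cognitive-only
message sharing: each primary encoder sees its own message only, the cognitive one sees all. -/
structure Code (𝒳 : Fin 3 → Type u) (𝒴 : Fin 3 → Type v) [∀ i, MeasurableSpace (𝒴 i)]
    (R : Fin 3 → ℝ) (N : ℕ) where
  enc₁ : Fin (numMsg N (R 0)) → Fin N → 𝒳 0
  enc₂ : Fin (numMsg N (R 1)) → Fin N → 𝒳 1
  enc₃ : Msg N R → Fin N → 𝒳 2
  dec : ∀ i, (Fin N → 𝒴 i) → Fin (numMsg N (R i))
  measurable_dec : ∀ i, Measurable (dec i)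

section

variable {𝒳 : Fin 3 → Type u} {𝒴 : Fin 3 → Type v}
  [∀ i, MeasurableSpace (𝒳 i)] [∀ i, MeasurableSpace (𝒴 i)]

/-- The channel inputs at time `t` when the messages are `w`. -/
def Code.input {R : Fin 3 → ℝ} {N : ℕ} (c : Code 𝒳 𝒴 R N) (w : Msg N R) (t : Fin N) :
    ∀ i, 𝒳 i
  | 0 => c.enc₁ (w 0) t
  | 1 => c.enc₂ (w 1) t
  | 2 => c.enc₃ w t

/-- The law of the outputs of `N` uses of the memoryless channel with input sequence `x`. -/
def blockLaw (ch : Kernel (∀ i, 𝒳 i) (∀ i, 𝒴 i)) {N : ℕ} (x : Fin N → ∀ i, 𝒳 i) :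
    Measure (Fin N → ∀ i, 𝒴 i) :=
  Measure.pi fun t => ch (x t)

/-- The error probability `ℙ[Ŵᵢ ≠ Wᵢ]` of user `i`. The messages are independent and uniform, so
it is the average over all message triples of the conditional error probabilities. -/
def Code.errorProb (ch : Kernel (∀ i, 𝒳 i) (∀ i, 𝒴 i)) {R : Fin 3 → ℝ} {N : ℕ}
    (c : Code 𝒳 𝒴 R N) (i : Fin 3) : ℝ :=
  (∑ w : Msg N R, (blockLaw ch (c.input w)).real {y | c.dec i (fun t => y t i) ≠ w i})
    / Fintype.card (Msg N R)

/-- The capacity region: all non-negative rate triples for which some sequence of codes, indexed by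
the block length, has vanishing maximal (over the users) average error probability. -/
def capacityRegion (ch : Kernel (∀ i, 𝒳 i) (∀ i, 𝒴 i)) : Set (Fin 3 → ℝ) :=
  {R | (∀ i, 0 ≤ R i) ∧
    ∃ c : ∀ N, Code 𝒳 𝒴 R N, Tendsto (fun N => ⨆ i, (c N).errorProb ch i) atTop (𝓝 0)}

/-- The rate triples that satisfy the seven bounds for the input distribution `P`; all mutual
informations are computed under the joint law `P ⊗ₘ ch` of inputs and outputs. -/
def outerRegion [∀ i, StandardBorelSpace (𝒴 i)] [∀ i, Nonempty (𝒴 i)]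
    (ch : Kernel (∀ i, 𝒳 i) (∀ i, 𝒴 i)) [IsMarkovKernel ch]
    (P : ProbabilityMeasure (∀ i, 𝒳 i)) : Set (Fin 3 → ℝ) :=
  let μ : Measure ((∀ i, 𝒳 i) × (∀ i, 𝒴 i)) := (P : Measure (∀ i, 𝒳 i)) ⊗ₘ ch
  let X₁ : (∀ i, 𝒳 i) × (∀ i, 𝒴 i) → 𝒳 0 := fun ω => ω.1 0
  let X₂ : (∀ i, 𝒳 i) × (∀ i, 𝒴 i) → 𝒳 1 := fun ω => ω.1 1
  let X₃ : (∀ i, 𝒳 i) × (∀ i, 𝒴 i) → 𝒳 2 := fun ω => ω.1 2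
  let Y₁ : (∀ i, 𝒳 i) × (∀ i, 𝒴 i) → 𝒴 0 := fun ω => ω.2 0
  let Y₂ : (∀ i, 𝒳 i) × (∀ i, 𝒴 i) → 𝒴 1 := fun ω => ω.2 1
  let Y₃ : (∀ i, 𝒳 i) × (∀ i, 𝒴 i) → 𝒴 2 := fun ω => ω.2 2
  {R |
    ENNReal.ofReal (R 0) ≤ condMutualInfo μ Y₁ (fun ω => (X₁ ω, X₃ ω)) X₂ ∧
    ENNReal.ofReal (R 1) ≤ condMutualInfo μ Y₂ (fun ω => (X₂ ω, X₃ ω)) X₁ ∧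
    ENNReal.ofReal (R 2) ≤ condMutualInfo μ Y₃ X₃ (fun ω => (X₁ ω, X₂ ω)) ∧
    ENNReal.ofReal (R 0 + R 2) ≤
      condMutualInfo μ Y₁ (fun ω => (X₁ ω, X₃ ω)) X₂
        + condMutualInfo μ Y₃ X₃ (fun ω => (X₂ ω, X₁ ω, Y₁ ω)) ∧
    ENNReal.ofReal (R 1 + R 2) ≤
      condMutualInfo μ Y₂ (fun ω => (X₂ ω, X₃ ω)) X₁
        + condMutualInfo μ Y₃ X₃ (fun ω => (X₁ ω, X₂ ω, Y₂ ω)) ∧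
    ENNReal.ofReal (R 0 + R 1 + R 2) ≤
      mutualInfo μ Y₁ (fun ω => (X₁ ω, X₂ ω, X₃ ω))
        + condMutualInfo μ Y₂ (fun ω => (X₂ ω, X₃ ω)) (fun ω => (X₁ ω, Y₁ ω))
        + condMutualInfo μ Y₃ X₃ (fun ω => (X₁ ω, Y₁ ω, X₂ ω, Y₂ ω)) ∧
    ENNReal.ofReal (R 1 + R 0 + R 2) ≤
      mutualInfo μ Y₂ (fun ω => (X₂ ω, X₁ ω, X₃ ω))
        + condMutualInfo μ Y₁ (fun ω => (X₁ ω, X₃ ω)) (fun ω => (X₂ ω, Y₂ ω))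
        + condMutualInfo μ Y₃ X₃ (fun ω => (X₂ ω, Y₂ ω, X₁ ω, Y₁ ω))}

end

end CIFC

end

/-
The converse compares the channel with fictitious channels over which decoding is a blind guess.
Such a channel is built by redrawing the outputs one user at a time, the cognitive user last: the
output of user `j` follows its conditional law given the earlier outputs and the inputs of some
primary users other than `j`. None of these inputs depends on the message of user `j`, so user `j`
decodes correctly exactly as often as by guessing, independently of the earlier users. By data
processing for the event of correct decoding, the divergence of the true block law from the
fictitious one is at least about the logarithm of the number of message tuples; by the chain rule,
it is `N` times a sum of conditional mutual informations under the input law at a uniformly chosen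
time. Hence the rates, lowered by a vanishing amount, lie in the union of the outer regions.

For finite input alphabets this union is closed: the input laws form a compact space, and each
conditional mutual information is upper semicontinuous in the input law `P`, because it is an
infimum over auxiliary output laws of divergences that are linear in `P`.
-/

open scoped NNReal

namespace CIFC

section Divergence

variable {α β : Type*} {mα : MeasurableSpace α} {mβ : MeasurableSpace β}

/- Fenchel's inequality: the convex conjugate of `klFun` is `a ↦ exp a - 1`. -/
lemma mul_sub_exp_sub_one_le_klFun (a : ℝ) {t : ℝ} (ht : 0 ≤ t) :
    a * t - (Real.exp a - 1) ≤ klFun t := by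
  rcases ht.eq_or_lt with rfl | ht
  · simp [klFun_zero, (Real.exp_pos a).le]
  have hlog := Real.log_le_sub_one_of_pos (div_pos (Real.exp_pos a) ht)
  rw [Real.log_div (Real.exp_pos a).ne' ht.ne', Real.log_exp] at hlog
  have hmul := mul_le_mul_of_nonneg_left hlog ht.le
  have hexp : t * (Real.exp a / t - 1) = Real.exp a - t := by field_simp
  rw [klFun_apply]
  linarith

lemma klFun_mul_add_le {u v : ℝ} (hu : 0 ≤ u) (hv₀ : 0 ≤ v) (hv₁ : v ≤ 1) :
    klFun (u * v) + v ≤ v * klFun u + 1 := by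
  rcases hu.eq_or_lt with rfl | hu
  · simp [klFun_zero]; linarith
  rcases hv₀.eq_or_lt with rfl | hv₀
  · simp [klFun_zero]
  have hlog : u * v * Real.log v ≤ 0 :=
    mul_nonpos_of_nonneg_of_nonpos (by positivity) (Real.log_nonpos hv₀.le hv₁)
  rw [klFun_apply, klFun_apply, Real.log_mul hu.ne' hv₀.ne']
  linarith

/-- With `A` the event of correct decoding, this plays the role of Fano's inequality. -/
lemma ofReal_measureReal_le_klDiv (μ ν : Measure α) [IsFiniteMeasure μ] [IsFiniteMeasure ν]
    (A : Set α) (s : ℝ) :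
    ENNReal.ofReal (s * μ.real A - (Real.exp s - 1) * ν.real A) ≤ klDiv μ ν := by
  by_cases h : klDiv μ ν = ∞
  · simp [h]
  obtain ⟨hac, hllr⟩ := klDiv_ne_top_iff.1 h
  have hkl := (integrable_klFun_rnDeriv_iff hac).2 hllr
  have hrn : Integrable (fun x => (μ.rnDeriv ν x).toReal) (ν.restrict A) :=
    Measure.integrable_toReal_rnDeriv.integrableOn
  rw [← ENNReal.ofReal_toReal h, toReal_klDiv_eq_integral_klFun hac]
  refine ENNReal.ofReal_le_ofReal ?_
  calc s * μ.real A - (Real.exp s - 1) * ν.real A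
      = ∫ x in A, (s * (μ.rnDeriv ν x).toReal - (Real.exp s - 1)) ∂ν := by
        rw [integral_sub (hrn.const_mul s) (integrable_const _), integral_const_mul,
          Measure.setIntegral_toReal_rnDeriv hac]
        simp [mul_comm]
    _ ≤ ∫ x in A, klFun (μ.rnDeriv ν x).toReal ∂ν :=
        integral_mono ((hrn.const_mul s).sub (integrable_const _)) hkl.integrableOn
          fun x => mul_sub_exp_sub_one_le_klFun s ENNReal.toReal_nonneg
    _ ≤ ∫ x, klFun (μ.rnDeriv ν x).toReal ∂ν :=
        setIntegral_le_integral hkl (.of_forall fun x => klFun_nonneg ENNReal.toReal_nonneg)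

lemma klDiv_add_measure_univ_le (μ : Measure α) {ν₁ ν₂ : Measure α} [IsFiniteMeasure μ]
    [IsFiniteMeasure ν₂] (h : ν₁ ≤ ν₂) :
    klDiv μ ν₂ + ν₁ Set.univ ≤ klDiv μ ν₁ + ν₂ Set.univ := by
  have : IsFiniteMeasure ν₁ := isFiniteMeasure_of_le ν₂ h
  by_cases hac : μ ≪ ν₁
  swap
  · simp [hac]
  have hac₂ := Measure.absolutelyContinuous_of_le h
  have hpoint : ∀ᵐ x ∂ν₂, ENNReal.ofReal (klFun (μ.rnDeriv ν₂ x).toReal) + ν₁.rnDeriv ν₂ x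
      ≤ ν₁.rnDeriv ν₂ x * ENNReal.ofReal (klFun (μ.rnDeriv ν₁ x).toReal) + 1 := by
    filter_upwards [Measure.rnDeriv_le_one_of_le h, Measure.rnDeriv_mul_rnDeriv (κ := ν₂) hac]
      with x hle hmul
    have hv : ν₁.rnDeriv ν₂ x = ENNReal.ofReal (ν₁.rnDeriv ν₂ x).toReal :=
      (ENNReal.ofReal_toReal (ne_top_of_le_ne_top ENNReal.one_ne_top hle)).symm
    have hv₁ : (ν₁.rnDeriv ν₂ x).toReal ≤ 1 := ENNReal.toReal_le_of_le_ofReal zero_le_one (by simpa)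
    rw [← hmul, Pi.mul_apply, ENNReal.toReal_mul, hv, ENNReal.toReal_ofReal ENNReal.toReal_nonneg,
      ← ENNReal.ofReal_add (klFun_nonneg (by positivity)) (by positivity),
      ← ENNReal.ofReal_mul (by positivity), ← ENNReal.ofReal_one,
      ← ENNReal.ofReal_add (mul_nonneg (by positivity) (klFun_nonneg (by positivity))) zero_le_one]
    exact ENNReal.ofReal_le_ofReal
      (klFun_mul_add_le ENNReal.toReal_nonneg ENNReal.toReal_nonneg hv₁)
  calc klDiv μ ν₂ + ν₁ Set.univ
      = ∫⁻ x, (ENNReal.ofReal (klFun (μ.rnDeriv ν₂ x).toReal) + ν₁.rnDeriv ν₂ x) ∂ν₂ := by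
        rw [lintegral_add_right _ (by fun_prop), Measure.lintegral_rnDeriv hac₂,
          klDiv_eq_lintegral_klFun_of_ac (hac.trans hac₂)]
    _ ≤ ∫⁻ x, (ν₁.rnDeriv ν₂ x * ENNReal.ofReal (klFun (μ.rnDeriv ν₁ x).toReal) + 1) ∂ν₂ :=
        lintegral_mono_ae hpoint
    _ = klDiv μ ν₁ + ν₂ Set.univ := by
        rw [lintegral_add_right _ measurable_const, lintegral_rnDeriv_mul hac₂ (by fun_prop),
          lintegral_one, klDiv_eq_lintegral_klFun_of_ac hac]

lemma klDiv_le_add_log_of_smul_le (μ : Measure α) {ν₁ ν₂ : Measure α} [IsProbabilityMeasure μ]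
    [IsProbabilityMeasure ν₁] [IsProbabilityMeasure ν₂] {a : ℝ≥0} (ha : a ≠ 0)
    (h : a • ν₁ ≤ ν₂) :
    klDiv μ ν₂ ≤ klDiv μ ν₁ + ENNReal.ofReal (-Real.log a) := by
  by_cases hfin : klDiv μ ν₁ = ∞
  · simp [hfin]
  obtain ⟨hac, hllr⟩ := klDiv_ne_top_iff.1 hfin
  have hmass : (a • ν₁) Set.univ = a := by rw [Measure.smul_apply, measure_univ]; simp
  have ha₁ : a ≤ 1 := by
    have := h Set.univ
    rw [hmass, measure_univ] at this
    exact_mod_cast this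
  have hlog : 0 ≤ -Real.log a := by
    simpa using Real.log_nonpos a.2 (by exact_mod_cast ha₁)
  have hfin_smul : klDiv μ (a • ν₁) ≠ ∞ := by
    refine klDiv_ne_top (hac.smul_right (ENNReal.coe_ne_zero.2 ha)) ?_
    rw [integrable_congr (llr_smul_nnreal_right hac a ha)]
    fun_prop
  have hsmul : klDiv μ (a • ν₁) + 1 = klDiv μ ν₁ + ENNReal.ofReal (-Real.log a) + a := by
    rw [← ENNReal.toReal_eq_toReal_iff' (by finiteness) (by finiteness),
      ENNReal.toReal_add hfin_smul ENNReal.one_ne_top,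
      ENNReal.toReal_add (by finiteness) ENNReal.coe_ne_top,
      ENNReal.toReal_add hfin ENNReal.ofReal_ne_top, toReal_klDiv_smul_right hac hllr ha,
      ENNReal.toReal_ofReal hlog, ENNReal.toReal_one, ENNReal.coe_toReal, probReal_univ,
      probReal_univ]
    ring
  have hle := klDiv_add_measure_univ_le μ h
  rw [hmass, measure_univ, hsmul] at hle
  exact (ENNReal.add_le_add_iff_right ENNReal.coe_ne_top).1 hle

lemma klDiv_map_of_leftInverse (μ ν : Measure α) [IsFiniteMeasure μ] [IsFiniteMeasure ν]
    {e : α → β} {g : β → α} (he : Measurable e) (hg : Measurable g)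
    (hge : Function.LeftInverse g e) : klDiv (μ.map e) (ν.map e) = klDiv μ ν := by
  refine le_antisymm (klDiv_map_le _ _ he) ?_
  have h := klDiv_map_le (μ.map e) (ν.map e) hg
  rwa [Measure.map_map hg he, Measure.map_map hg he, hge.comp_eq_id, Measure.map_id,
    Measure.map_id] at h

lemma klDiv_prod (μ ν : Measure α) (μ' ν' : Measure β) [IsProbabilityMeasure μ]
    [IsProbabilityMeasure ν] [IsProbabilityMeasure μ'] [IsProbabilityMeasure ν'] :
    klDiv (μ.prod μ') (ν.prod ν') = klDiv μ ν + klDiv μ' ν' := by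
  rw [← Measure.compProd_const, ← Measure.compProd_const, klDiv_compProd_eq_add,
    Measure.compProd_const, Measure.compProd_const]
  congr 1
  rw [← klDiv_map_of_leftInverse (μ.prod μ') (μ.prod ν') measurable_swap measurable_swap
    Prod.swap_leftInverse, Measure.prod_swap, Measure.prod_swap, ← Measure.compProd_const,
    ← Measure.compProd_const, klDiv_compProd_left]

lemma klDiv_pi {n : ℕ} {E : Fin n → Type*} [∀ i, MeasurableSpace (E i)]
    (μ ν : ∀ i, Measure (E i)) [∀ i, IsProbabilityMeasure (μ i)]
    [∀ i, IsProbabilityMeasure (ν i)] :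
    klDiv (Measure.pi μ) (Measure.pi ν) = ∑ i, klDiv (μ i) (ν i) := by
  induction n with
  | zero => simp [Measure.pi_of_empty μ, Measure.pi_of_empty ν]
  | succ n ih =>
    rw [← klDiv_map_of_leftInverse _ _ (MeasurableEquiv.piFinSuccAbove E 0).measurable
      (MeasurableEquiv.piFinSuccAbove E 0).symm.measurable
      (MeasurableEquiv.piFinSuccAbove E 0).left_inv,
      (measurePreserving_piFinSuccAbove μ 0).map_eq, (measurePreserving_piFinSuccAbove ν 0).map_eq,
      klDiv_prod, ih, Fin.sum_univ_succ]
    rfl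

lemma klDiv_kernel_of_ac [MeasurableSpace.CountableOrCountablyGenerated α β] {κ η : Kernel α β}
    [IsFiniteKernel κ] [IsFiniteKernel η] {a : α} (h : κ a ≪ η a) :
    klDiv (κ a) (η a) = ∫⁻ y, ENNReal.ofReal (klFun (κ.rnDeriv η a y).toReal) ∂η a := by
  rw [klDiv_eq_lintegral_klFun_of_ac h]
  refine lintegral_congr_ae ?_
  filter_upwards [Kernel.rnDeriv_eq_rnDeriv_measure (κ := κ) (η := η) (a := a)] with y hy
  rw [hy]

lemma measurable_klDiv_kernel [MeasurableSpace.CountableOrCountablyGenerated α β]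
    (κ η : Kernel α β) [IsFiniteKernel κ] [IsFiniteKernel η] :
    Measurable fun a => klDiv (κ a) (η a) := by
  classical
  have := Kernel.measurable_rnDeriv κ η
  have hint : Measurable fun a => ∫⁻ y, ENNReal.ofReal (klFun (κ.rnDeriv η a y).toReal) ∂η a :=
    Measurable.lintegral_kernel_prod_right (by fun_prop)
  have hite : (fun a => klDiv (κ a) (η a)) = fun a => if κ a ≪ η a
      then ∫⁻ y, ENNReal.ofReal (klFun (κ.rnDeriv η a y).toReal) ∂η a else ∞ := by
    funext a
    split_ifs with h
    exacts [klDiv_kernel_of_ac h, klDiv_of_not_ac h]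
  rw [hite]
  exact Measurable.ite (Kernel.measurableSet_absolutelyContinuous κ η) hint measurable_const

lemma klDiv_compProd_eq_lintegral [MeasurableSpace.CountableOrCountablyGenerated α β]
    (P : Measure α) [IsFiniteMeasure P] (κ η : Kernel α β) [IsFiniteKernel κ] [IsFiniteKernel η] :
    klDiv (P ⊗ₘ κ) (P ⊗ₘ η) = ∫⁻ a, klDiv (κ a) (η a) ∂P := by
  by_cases hac : ∀ᵐ a ∂P, κ a ≪ η a
  · have hκ : P ⊗ₘ κ = (P ⊗ₘ η).withDensity fun p => κ.rnDeriv η p.1 p.2 := by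
      rw [← Measure.compProd_withDensity (Kernel.measurable_rnDeriv κ η)]
      refine Measure.compProd_congr ?_
      filter_upwards [hac] with a ha
      exact (Kernel.withDensity_rnDeriv_eq ha).symm
    have hrn : (P ⊗ₘ κ).rnDeriv (P ⊗ₘ η) =ᵐ[P ⊗ₘ η] fun p => κ.rnDeriv η p.1 p.2 := by
      rw [hκ]
      exact Measure.rnDeriv_withDensity _ (Kernel.measurable_rnDeriv κ η)
    have := Kernel.measurable_rnDeriv κ η
    calc klDiv (P ⊗ₘ κ) (P ⊗ₘ η)
        = ∫⁻ p, ENNReal.ofReal (klFun (κ.rnDeriv η p.1 p.2).toReal) ∂(P ⊗ₘ η) := by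
          rw [klDiv_eq_lintegral_klFun_of_ac
            (Measure.absolutelyContinuous_compProd_right_iff.2 hac)]
          exact lintegral_congr_ae (hrn.mono fun p hp => by simp only [hp])
      _ = ∫⁻ a, ∫⁻ y, ENNReal.ofReal (klFun (κ.rnDeriv η a y).toReal) ∂η a ∂P :=
          Measure.lintegral_compProd (by fun_prop)
      _ = ∫⁻ a, klDiv (κ a) (η a) ∂P :=
          lintegral_congr_ae (hac.mono fun a ha => (klDiv_kernel_of_ac ha).symm)
  · rw [klDiv_of_not_ac (mt (Measure.absolutelyContinuous_compProd_right_iff).1 hac), eq_comm,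
      eq_top_iff]
    have hS := Kernel.measurableSet_absolutelyContinuous κ η
    calc ∞ = ∫⁻ _ in {a | κ a ≪ η a}ᶜ, ∞ ∂P := by
          rw [setLIntegral_const, ENNReal.top_mul]
          rwa [ae_iff] at hac
      _ ≤ ∫⁻ a in {a | κ a ≪ η a}ᶜ, klDiv (κ a) (η a) ∂P :=
          setLIntegral_mono' hS.compl fun a ha => (klDiv_of_not_ac ha).ge
      _ ≤ ∫⁻ a, klDiv (κ a) (η a) ∂P := setLIntegral_le_lintegral _ _

end Divergence

section ConditionalInformation

variable {Ω α β γ : Type*} [MeasurableSpace Ω] [MeasurableSpace α] [MeasurableSpace β]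
  [MeasurableSpace γ]

lemma compProd_comap_map (m : Measure β) [SFinite m] (Q : Kernel γ α) [IsSFiniteKernel Q]
    {e : β → γ} (he : Measurable e) :
    (m ⊗ₘ Q.comap e he).map (Prod.map e id) = m.map e ⊗ₘ Q := by
  have hem : Measurable (Prod.map e (id : α → α)) := he.prodMap measurable_id
  ext s hs
  rw [Measure.map_apply hem hs, Measure.compProd_apply (hem hs), Measure.compProd_apply hs,
    lintegral_map (Kernel.measurable_kernel_prodMk_left hs) he]
  rfl

lemma compProd_prodMkRight_map_swap (m : Measure γ) [SFinite m] (κ : Kernel γ β)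
    [IsSFiniteKernel κ] (η : Kernel γ α) [IsSFiniteKernel η] :
    ((m ⊗ₘ κ) ⊗ₘ η.prodMkRight β).map (fun p => ((p.1.1, p.2), p.1.2))
      = (m ⊗ₘ η) ⊗ₘ κ.prodMkRight α := by
  refine Measure.ext_of_lintegral _ fun f hf => ?_
  rw [lintegral_map hf (by fun_prop), Measure.lintegral_compProd (by fun_prop),
    Measure.lintegral_compProd (by fun_prop), Measure.lintegral_compProd hf,
    Measure.lintegral_compProd (by fun_prop)]
  simp only [Kernel.prodMkRight_apply]
  exact lintegral_congr fun z =>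
    lintegral_lintegral_swap (f := fun x y => f ((z, y), x)) (by fun_prop)

lemma map_prodMk_le_prod_count [Countable β] [MeasurableSingletonClass β] (μ : Measure Ω)
    [SFinite μ] {A : Ω → α} (hA : Measurable A) {X : Ω → β} (hX : Measurable X) :
    μ.map (fun ω => (A ω, X ω)) ≤ (μ.map A).prod Measure.count := by
  refine Measure.le_iff.2 fun s hs => ?_
  rw [Measure.map_apply (hA.prodMk hX) hs, Measure.prod_apply_symm hs, lintegral_count]
  have hs' : ∀ x, MeasurableSet ((fun a => (a, x)) ⁻¹' s) := fun x => hs.preimage (by fun_prop)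
  simp_rw [Measure.map_apply hA (hs' _)]
  refine (measure_mono fun ω hω => ?_).trans (measure_iUnion_le _)
  exact Set.mem_iUnion.2 ⟨X ω, hω⟩

variable (μ : Measure Ω) [IsFiniteMeasure μ]

lemma klDiv_compProd_comap_eq {𝒜 : Type*} [MeasurableSpace 𝒜] {A : Ω → 𝒜} (hA : Measurable A)
    {Y : Ω → α} (hY : Measurable Y) {Z : 𝒜 → γ} (hZ : Measurable Z) {ξ : 𝒜 → β}
    (hξ : Measurable ξ) {g : γ × β → 𝒜} (hg : Measurable g) (hge : ∀ a, g (Z a, ξ a) = a)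
    (Q : Kernel γ α) [IsFiniteKernel Q] :
    klDiv (μ.map fun ω => (A ω, Y ω)) (μ.map A ⊗ₘ Q.comap Z hZ)
      = klDiv (μ.map fun ω => ((Z (A ω), ξ (A ω)), Y ω))
          ((μ.map fun ω => (Z (A ω), ξ (A ω))) ⊗ₘ Q.prodMkRight β) := by
  set e : 𝒜 → γ × β := fun a => (Z a, ξ a)
  have he : Measurable e := hZ.prodMk hξ
  have hjoint : (μ.map fun ω => (e (A ω), Y ω))
      = (μ.map fun ω => (A ω, Y ω)).map (Prod.map e id) := by
    rw [Measure.map_map (he.prodMap measurable_id) (hA.prodMk hY)]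
    rfl
  have hinput : (μ.map fun ω => e (A ω)) = (μ.map A).map e := by
    rw [Measure.map_map he hA]
    rfl
  have hkernel : Q.comap Z hZ = (Q.prodMkRight β).comap e he := rfl
  change _ = klDiv (μ.map fun ω => (e (A ω), Y ω)) ((μ.map fun ω => e (A ω)) ⊗ₘ Q.prodMkRight β)
  rw [hjoint, hinput, hkernel, ← compProd_comap_map _ _ he]
  exact (klDiv_map_of_leftInverse _ _ (he.prodMap measurable_id) (hg.prodMap measurable_id)
    fun p => Prod.ext (hge p.1) rfl).symm

variable [StandardBorelSpace α] [Nonempty α]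

lemma condMutualInfo_mul_log (Y : Ω → α) (X : Ω → β) (Z : Ω → γ) :
    condMutualInfo μ Y X Z * ENNReal.ofReal (Real.log 2)
      = klDiv (μ.map fun ω => ((Z ω, X ω), Y ω))
          ((μ.map fun ω => (Z ω, X ω)) ⊗ₘ (condDistrib Y Z μ).prodMkRight β) :=
  ENNReal.div_mul_cancel (by simpa using Real.log_pos one_lt_two) ENNReal.ofReal_ne_top

lemma mutualInfo_eq_condMutualInfo (μ : Measure Ω) [IsProbabilityMeasure μ] {Y : Ω → α}
    (hY : Measurable Y) {X : Ω → β} (hX : Measurable X) :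
    mutualInfo μ Y X = condMutualInfo μ Y X fun _ => () := by
  have : IsProbabilityMeasure (μ.map Y) := Measure.isProbabilityMeasure_map hY.aemeasurable
  have hcond : condDistrib Y (fun _ : Ω => ()) μ = Kernel.const Unit (μ.map Y) := by
    have h := condDistrib_ae_eq_of_measure_eq_compProd (μ := μ) (fun _ : Ω => ())
      (κ := Kernel.const Unit (μ.map Y)) hY.aemeasurable (by
        rw [Measure.map_const, measure_univ, one_smul, Measure.dirac_unit_compProd_const,
          Measure.map_map (by fun_prop) hY]
        rfl)
    rw [Measure.map_const, measure_univ, one_smul] at h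
    ext1 u
    rwa [EventuallyEq, ae_dirac_eq] at h
  have h := klDiv_compProd_comap_eq μ hX hY (Z := fun _ : β => ()) measurable_const
    measurable_id measurable_snd (fun _ => rfl) (Kernel.const Unit (μ.map Y))
  simp only [id] at h
  rw [mutualInfo, condMutualInfo, hcond, ← h, ← Measure.compProd_const]
  rfl

variable {Y : Ω → α} (hY : Measurable Y) {X : Ω → β} (hX : Measurable X) {Z : Ω → γ}
  (hZ : Measurable Z)
include hY hX hZ

omit [StandardBorelSpace α] [Nonempty α] in
lemma klDiv_compProd_prodMkRight_eq_add [StandardBorelSpace β] [Nonempty β] (Q : Kernel γ α)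
    [IsMarkovKernel Q] :
    klDiv (μ.map fun ω => ((Z ω, X ω), Y ω)) ((μ.map fun ω => (Z ω, X ω)) ⊗ₘ Q.prodMkRight β)
      = klDiv (μ.map fun ω => (Z ω, Y ω)) (μ.map Z ⊗ₘ Q)
        + klDiv (μ.map fun ω => ((Z ω, Y ω), X ω))
            ((μ.map fun ω => (Z ω, Y ω)) ⊗ₘ (condDistrib X Z μ).prodMkRight α) := by
  have hswap : Measurable fun p : (γ × β) × α => ((p.1.1, p.2), p.1.2) := by fun_prop
  rw [← klDiv_map_of_leftInverse _ _ hswap (g := fun p => ((p.1.1, p.2), p.1.2)) (by fun_prop)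
      fun _ => rfl, Measure.map_map hswap (by fun_prop),
    ← compProd_map_condDistrib (μ := μ) (X := Z) hX.aemeasurable, compProd_prodMkRight_map_swap,
    ← compProd_map_condDistrib (μ := μ) (X := fun ω => (Z ω, Y ω)) hX.aemeasurable,
    ← klDiv_compProd_eq_add, compProd_map_condDistrib hX.aemeasurable]
  rfl

/-- The golden formula: `Q = P_{Y|Z}` minimizes the right-hand side. -/
lemma condMutualInfo_mul_log_le [StandardBorelSpace β] [Nonempty β] (Q : Kernel γ α)
    [IsMarkovKernel Q] :
    condMutualInfo μ Y X Z * ENNReal.ofReal (Real.log 2)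
      ≤ klDiv (μ.map fun ω => ((Z ω, X ω), Y ω))
          ((μ.map fun ω => (Z ω, X ω)) ⊗ₘ Q.prodMkRight β) := by
  rw [condMutualInfo_mul_log, klDiv_compProd_prodMkRight_eq_add μ hY hX hZ Q,
    klDiv_compProd_prodMkRight_eq_add μ hY hX hZ, compProd_map_condDistrib hY.aemeasurable,
    klDiv_self, zero_add]
  exact le_add_self

lemma condMutualInfo_ne_top [Finite β] [MeasurableSingletonClass β] :
    condMutualInfo μ Y X Z ≠ ∞ := by
  have := Fintype.ofFinite β
  have hle : (μ.map fun ω => ((Z ω, X ω), Y ω))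
      ≤ ((μ.map Z).prod Measure.count) ⊗ₘ (condDistrib Y Z μ).prodMkRight β := by
    have hswap : Measurable fun p : (γ × α) × β => ((p.1.1, p.2), p.1.2) := by fun_prop
    calc (μ.map fun ω => ((Z ω, X ω), Y ω))
        = (μ.map fun ω => ((Z ω, Y ω), X ω)).map fun p => ((p.1.1, p.2), p.1.2) :=
          (Measure.map_map hswap ((hZ.prodMk hY).prodMk hX)).symm
      _ ≤ ((μ.map fun ω => (Z ω, Y ω)).prod Measure.count).map fun p => ((p.1.1, p.2), p.1.2) :=
          Measure.map_mono (map_prodMk_le_prod_count μ (hZ.prodMk hY) hX) hswap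
      _ = _ := by
          rw [← compProd_map_condDistrib hY.aemeasurable, ← Measure.compProd_const,
            ← Measure.compProd_const]
          exact compProd_prodMkRight_map_swap _ _ (Kernel.const γ Measure.count)
  have hfin : klDiv (μ.map fun ω => ((Z ω, X ω), Y ω))
      (((μ.map Z).prod Measure.count) ⊗ₘ (condDistrib Y Z μ).prodMkRight β) ≠ ∞ :=
    ne_top_of_le_ne_top (by simp only [klDiv_self]; finiteness)
      (le_self_add.trans (klDiv_add_measure_univ_le _ hle))
  intro htop
  refine hfin ?_
  rw [← compProd_map_condDistrib (μ := μ) (X := fun ω => (Z ω, X ω)) hY.aemeasurable,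
    klDiv_compProd_eq_add, compProd_map_condDistrib hY.aemeasurable, ← condMutualInfo_mul_log, htop]
  simp [ENNReal.top_mul, Real.log_pos one_lt_two]

end ConditionalInformation

section Reparametrization

variable {Ω α β β' γ γ' : Type*} [MeasurableSpace Ω] [MeasurableSpace α] [StandardBorelSpace α]
  [Nonempty α] [MeasurableSpace β] [MeasurableSpace β'] [MeasurableSpace γ] [MeasurableSpace γ']
  (μ : Measure Ω) [IsFiniteMeasure μ] {Y : Ω → α} (hY : Measurable Y) {Z : Ω → γ}
  (hZ : Measurable Z) {e : γ → γ'} (he : Measurable e) {e' : γ' → γ} (he' : Measurable e')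
  (hee' : Function.LeftInverse e' e)
include hY hZ he he' hee'

lemma condDistrib_comp_ae_eq_of_leftInverse :
    condDistrib Y Z μ =ᵐ[μ.map Z] (condDistrib Y (fun ω => e (Z ω)) μ).comap e he := by
  refine condDistrib_ae_eq_of_measure_eq_compProd Z hY.aemeasurable ?_
  have hinv : (Prod.map e' id : γ' × α → γ × α) ∘ Prod.map e id = id :=
    funext fun p => Prod.ext (hee' p.1) rfl
  have hem : Measurable (Prod.map e (id : α → α)) := he.prodMap measurable_id
  have hem' : Measurable (Prod.map e' (id : α → α)) := he'.prodMap measurable_id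
  have h : (μ.map fun ω => (Z ω, Y ω)).map (Prod.map e id)
      = (μ.map Z ⊗ₘ (condDistrib Y (fun ω => e (Z ω)) μ).comap e he).map (Prod.map e id) := by
    rw [compProd_comap_map, Measure.map_map he hZ, Measure.map_map hem (hZ.prodMk hY)]
    exact (compProd_map_condDistrib hY.aemeasurable).symm
  have h' := congrArg (Measure.map (Prod.map e' id)) h
  rwa [Measure.map_map hem' hem, Measure.map_map hem' hem, hinv, Measure.map_id,
    Measure.map_id] at h'

/-- The hypotheses say that `Z'` is equivalent to `Z`, and `X'` to `X` given `Z`. -/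
lemma condMutualInfo_congr {X : Ω → β} (hX : Measurable X) {f : γ × β → β'} (hf : Measurable f)
    {f' : γ' × β' → β} (hf' : Measurable f') (hff' : ∀ p : γ × β, f' (e p.1, f p) = p.2)
    {X' : Ω → β'} (hX' : ∀ ω, X' ω = f (Z ω, X ω)) {Z' : Ω → γ'} (hZ' : ∀ ω, Z' ω = e (Z ω)) :
    condMutualInfo μ Y X' Z' = condMutualInfo μ Y X Z := by
  obtain rfl : X' = fun ω => f (Z ω, X ω) := funext hX'
  obtain rfl : Z' = fun ω => e (Z ω) := funext hZ'
  have hefst : Measurable fun p : γ × β => e p.1 := he.comp measurable_fst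
  have hcond : (condDistrib Y Z μ).prodMkRight β =ᵐ[μ.map fun ω => (Z ω, X ω)]
      (condDistrib Y (fun ω => e (Z ω)) μ).comap _ hefst := by
    have hfst : μ.map Z = (μ.map fun ω => (Z ω, X ω)).map Prod.fst :=
      (Measure.map_map measurable_fst (hZ.prodMk hX)).symm
    have h := condDistrib_comp_ae_eq_of_leftInverse μ hY hZ he he' hee'
    rw [hfst] at h
    exact ae_of_ae_map measurable_fst.aemeasurable h
  rw [condMutualInfo, condMutualInfo, Measure.compProd_congr hcond,
    klDiv_compProd_comap_eq μ (hZ.prodMk hX) hY hefst hf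
      (g := fun q => (e' q.1, f' q)) ((he'.comp measurable_fst).prodMk hf')
      fun p => Prod.ext (hee' p.1) (hff' p)]

end Reparametrization

section MixKernel

variable {α β : Type*} [MeasurableSpace α] [MeasurableSpace β]

/-- The mixture of two kernels with weights `a` and `1 - a`, for `a ≤ 1`. -/
noncomputable def mixKernel (a : ℝ≥0) (κ η : Kernel α β) : Kernel α β where
  toFun x := a • κ x + (1 - a) • η x
  measurable' := by
    refine Measure.measurable_of_measurable_coe _ fun s hs => ?_
    simp only [Measure.coe_add, Measure.coe_smul, Pi.add_apply, Pi.smul_apply]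
    exact ((κ.measurable_coe hs).const_smul a).add ((η.measurable_coe hs).const_smul (1 - a))

lemma smul_le_mixKernel_left (a : ℝ≥0) (κ η : Kernel α β) (x : α) :
    a • κ x ≤ mixKernel a κ η x :=
  Measure.le_add_right le_rfl

lemma smul_le_mixKernel_right (a : ℝ≥0) (κ η : Kernel α β) (x : α) :
    (1 - a) • η x ≤ mixKernel a κ η x :=
  Measure.le_add_left le_rfl

lemma isMarkovKernel_mixKernel {a : ℝ≥0} (ha : a ≤ 1) (κ η : Kernel α β) [IsMarkovKernel κ]
    [IsMarkovKernel η] : IsMarkovKernel (mixKernel a κ η) := by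
  refine ⟨fun x => ⟨?_⟩⟩
  change (a • κ x + (1 - a) • η x) Set.univ = 1
  simp only [Measure.coe_add, Measure.coe_nnreal_smul_apply, Pi.add_apply, measure_univ, mul_one]
  exact_mod_cast add_tsub_cancel_of_le ha

lemma klDiv_compProd_le_add_log_of_smul_le (μ : Measure (α × β)) [IsProbabilityMeasure μ]
    (m : Measure α) [IsProbabilityMeasure m] {κ η : Kernel α β} [IsMarkovKernel κ]
    [IsMarkovKernel η] {a : ℝ≥0} (ha : a ≠ 0) (h : ∀ x, a • κ x ≤ η x) :
    klDiv μ (m ⊗ₘ η) ≤ klDiv μ (m ⊗ₘ κ) + ENNReal.ofReal (-Real.log a) := by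
  refine klDiv_le_add_log_of_smul_le μ ha (Measure.le_iff.2 fun s hs => ?_)
  rw [Measure.coe_nnreal_smul_apply, Measure.compProd_apply hs, Measure.compProd_apply hs,
    ← lintegral_const_mul _ (Kernel.measurable_kernel_prodMk_left hs)]
  exact lintegral_mono fun x => h x _

end MixKernel

section Channel

variable {𝒳 𝒴 E α : Type*} [MeasurableSpace 𝒳] [MeasurableSpace 𝒴] [MeasurableSpace E]
  [MeasurableSpace α] [StandardBorelSpace α] [Nonempty α] (P : Measure 𝒳) [IsFiniteMeasure P]
  (ch : Kernel 𝒳 𝒴) [IsMarkovKernel ch] {O : 𝒴 → E} (hO : Measurable O) {y : 𝒴 → α}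
  (hy : Measurable y)
include hO hy

lemma klDiv_compProd_append (V : Kernel 𝒳 E) [IsMarkovKernel V] (K : Kernel (𝒳 × E) α)
    [IsMarkovKernel K] :
    klDiv (P ⊗ₘ ch.map fun o => (O o, y o)) (P ⊗ₘ (V ⊗ₖ K))
      = klDiv (P ⊗ₘ ch.map O) (P ⊗ₘ V)
        + klDiv ((P ⊗ₘ ch).map fun ω => ((ω.1, O ω.2), y ω.2))
            ((P ⊗ₘ ch).map (fun ω => (ω.1, O ω.2)) ⊗ₘ K) := by
  have : IsMarkovKernel (ch.map O) := Kernel.IsMarkovKernel.map _ hO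
  have hinput : P ⊗ₘ ch.map O = (P ⊗ₘ ch).map fun ω => (ω.1, O ω.2) := Measure.compProd_map hO
  have hjoint : P ⊗ₘ ch.map (fun o => (O o, y o)) = (P ⊗ₘ ch).map fun ω => (ω.1, O ω.2, y ω.2) :=
    Measure.compProd_map (hO.prodMk hy)
  have hcond : (P ⊗ₘ ch).map (fun ω => ((ω.1, O ω.2), y ω.2))
      = (P ⊗ₘ ch.map O) ⊗ₘ condDistrib (fun ω => y ω.2) (fun ω => (ω.1, O ω.2)) (P ⊗ₘ ch) := by
    rw [hinput, compProd_map_condDistrib (by fun_prop)]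
  rw [← klDiv_map_of_leftInverse _ _ MeasurableEquiv.prodAssoc.symm.measurable
    MeasurableEquiv.prodAssoc.measurable MeasurableEquiv.prodAssoc.right_inv,
    Measure.compProd_assoc, hjoint, Measure.map_map (MeasurableEquiv.measurable _) (by fun_prop)]
  change klDiv ((P ⊗ₘ ch).map fun ω => ((ω.1, O ω.2), y ω.2)) _ = _
  rw [← hinput, hcond, klDiv_compProd_eq_add]

lemma klDiv_map_compProd_eq_lintegral [MeasurableSpace.CountableOrCountablyGenerated 𝒳 (E × α)]
    (K : Kernel (𝒳 × E) α) [IsMarkovKernel K] :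
    klDiv ((P ⊗ₘ ch).map fun ω => ((ω.1, O ω.2), y ω.2))
        ((P ⊗ₘ ch).map (fun ω => (ω.1, O ω.2)) ⊗ₘ K)
      = ∫⁻ x, klDiv (ch.map (fun o => (O o, y o)) x) ((ch.map O ⊗ₖ K) x) ∂P := by
  have : IsMarkovKernel (ch.map O) := Kernel.IsMarkovKernel.map _ hO
  have : IsMarkovKernel (ch.map fun o => (O o, y o)) := Kernel.IsMarkovKernel.map _ (by fun_prop)
  rw [← klDiv_compProd_eq_lintegral, klDiv_compProd_append P ch hO hy, klDiv_self, zero_add]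

end Channel

section ChannelInfo

variable {𝒳 𝒴 E α γ : Type*} [MeasurableSpace 𝒳] [MeasurableSpace 𝒴] [MeasurableSpace E]
  [MeasurableSpace α] [StandardBorelSpace α] [Nonempty α] [MeasurableSpace γ]

/-- The conditional mutual information `I(y(Y); X | ζ(X), O(Y))` in bits between the channel input
`X` of law `P` and a function `y` of the channel output `Y`, given functions of both. -/
noncomputable def channelInfo (ch : Kernel 𝒳 𝒴) [IsMarkovKernel ch] (y : 𝒴 → α) (ζ : 𝒳 → γ)
    (O : 𝒴 → E) (P : Measure 𝒳) [IsFiniteMeasure P] : ℝ≥0∞ :=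
  condMutualInfo (P ⊗ₘ ch) (fun ω => y ω.2) (fun ω => ω.1) (fun ω => (ζ ω.1, O ω.2))

variable (ch : Kernel 𝒳 𝒴) [IsMarkovKernel ch] {y : 𝒴 → α} (hy : Measurable y) {ζ : 𝒳 → γ}
  (hζ : Measurable ζ) {O : 𝒴 → E} (hO : Measurable O)
include hy hζ hO

lemma channelInfo_mul_log_eq_klDiv (P : Measure 𝒳) [IsFiniteMeasure P] :
    channelInfo ch y ζ O P * ENNReal.ofReal (Real.log 2)
      = klDiv ((P ⊗ₘ ch).map fun ω => ((ω.1, O ω.2), y ω.2))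
          ((P ⊗ₘ ch).map (fun ω => (ω.1, O ω.2)) ⊗ₘ
            (condDistrib (fun ω => y ω.2) (fun ω => (ζ ω.1, O ω.2)) (P ⊗ₘ ch)).comap
              (Prod.map ζ id) (hζ.prodMap measurable_id)) := by
  rw [channelInfo, condMutualInfo_mul_log]
  exact (klDiv_compProd_comap_eq (P ⊗ₘ ch) (A := fun ω => (ω.1, O ω.2)) (by fun_prop)
    (Y := fun ω => y ω.2) (by fun_prop) (hζ.prodMap measurable_id) measurable_fst
    (g := fun p => (p.2, p.1.2)) (by fun_prop) (fun _ => rfl) _).symm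

section lintegral

variable [MeasurableSpace.CountableOrCountablyGenerated 𝒳 (E × α)]

lemma channelInfo_mul_log_eq_lintegral (P : Measure 𝒳) [IsFiniteMeasure P] :
    channelInfo ch y ζ O P * ENNReal.ofReal (Real.log 2)
      = ∫⁻ x, klDiv (ch.map (fun o => (O o, y o)) x) ((ch.map O ⊗ₖ
          (condDistrib (fun ω => y ω.2) (fun ω => (ζ ω.1, O ω.2)) (P ⊗ₘ ch)).comap
            (Prod.map ζ id) (hζ.prodMap measurable_id)) x) ∂P := by
  rw [channelInfo_mul_log_eq_klDiv ch hy hζ hO, klDiv_map_compProd_eq_lintegral P ch hO hy]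

lemma channelInfo_mul_log_le_lintegral [StandardBorelSpace 𝒳] [Nonempty 𝒳] (P : Measure 𝒳)
    [IsFiniteMeasure P] (Q : Kernel (γ × E) α) [IsMarkovKernel Q] :
    channelInfo ch y ζ O P * ENNReal.ofReal (Real.log 2)
      ≤ ∫⁻ x, klDiv (ch.map (fun o => (O o, y o)) x)
          ((ch.map O ⊗ₖ Q.comap (Prod.map ζ id) (hζ.prodMap measurable_id)) x) ∂P := by
  rw [← klDiv_map_compProd_eq_lintegral P ch hO hy, klDiv_compProd_comap_eq (P ⊗ₘ ch)
    (A := fun ω => (ω.1, O ω.2)) (by fun_prop) (Y := fun ω => y ω.2) (by fun_prop) _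
    measurable_fst (g := fun p => (p.2, p.1.2)) (by fun_prop) (fun _ => rfl)]
  exact condMutualInfo_mul_log_le _ (by fun_prop) (by fun_prop) (by fun_prop) Q

end lintegral

omit [StandardBorelSpace α] [Nonempty α] hζ in
lemma klDiv_map_compProd_le_add_log {K K' : Kernel (𝒳 × E) α} [IsMarkovKernel K]
    [IsMarkovKernel K'] {a : ℝ≥0} (ha : a ≠ 0) (h : ∀ p, a • K p ≤ K' p) (x : 𝒳) :
    klDiv (ch.map (fun o => (O o, y o)) x) ((ch.map O ⊗ₖ K') x)
      ≤ klDiv (ch.map (fun o => (O o, y o)) x) ((ch.map O ⊗ₖ K) x)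
        + ENNReal.ofReal (-Real.log a) := by
  have : IsMarkovKernel (ch.map O) := Kernel.IsMarkovKernel.map _ hO
  have : IsMarkovKernel (ch.map fun o => (O o, y o)) := Kernel.IsMarkovKernel.map _ (by fun_prop)
  rw [Kernel.compProd_apply_eq_compProd_sectR, Kernel.compProd_apply_eq_compProd_sectR]
  exact klDiv_compProd_le_add_log_of_smul_le _ _ ha fun o => h _

end ChannelInfo

section Semicontinuity

lemma continuous_lintegral_coe {𝒳 : Type*} [Finite 𝒳] [MeasurableSpace 𝒳] [TopologicalSpace 𝒳]
    [DiscreteTopology 𝒳] [OpensMeasurableSpace 𝒳] (d : 𝒳 → ℝ≥0) :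
    Continuous fun P : ProbabilityMeasure 𝒳 => ∫⁻ x, d x ∂P := by
  have := Fintype.ofFinite 𝒳
  refine continuous_iff_continuousAt.2 fun P => ?_
  exact ProbabilityMeasure.tendsto_iff_forall_lintegral_tendsto.1 tendsto_id
    (BoundedContinuousFunction.mkOfCompact ⟨d, continuous_of_discreteTopology⟩)

variable {𝒳 𝒴 E α γ : Type*} [MeasurableSpace 𝒳] [Finite 𝒳] [MeasurableSpace 𝒴]
  [MeasurableSpace E] [MeasurableSpace α] [StandardBorelSpace α] [Nonempty α] [MeasurableSpace γ]
  (ch : Kernel 𝒳 𝒴) [IsMarkovKernel ch] {y : 𝒴 → α} (hy : Measurable y) {ζ : 𝒳 → γ}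
  (hζ : Measurable ζ) {O : 𝒴 → E} (hO : Measurable O)
include hy hζ hO

lemma exists_kernel_forall_klDiv_ne_top [MeasurableSingletonClass 𝒳] :
    ∃ Q : Kernel (γ × E) α, IsMarkovKernel Q ∧ ∀ x, klDiv (ch.map (fun o => (O o, y o)) x)
      ((ch.map O ⊗ₖ Q.comap (Prod.map ζ id) (hζ.prodMap measurable_id)) x) ≠ ∞ := by
  have := Fintype.ofFinite 𝒳
  refine ⟨condDistrib (fun ω => y ω.2) (fun ω => (ζ ω.1, O ω.2)) (Measure.count ⊗ₘ ch),
    inferInstance, ENNReal.ne_top_of_tsum_ne_top ?_⟩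
  rw [← lintegral_count, ← channelInfo_mul_log_eq_lintegral ch hy hζ hO]
  exact ENNReal.mul_ne_top
    (condMutualInfo_ne_top _ (by fun_prop) (by fun_prop) (by fun_prop)) ENNReal.ofReal_ne_top

/-- `d` is the divergence from a mixture of the output law under `P`, which alone would be optimal
at `P`, with a little of a law that makes the divergence finite at every input. -/
lemma exists_forall_channelInfo_mul_log_le [MeasurableSingletonClass 𝒳] (P : ProbabilityMeasure 𝒳)
    {ε : ℝ≥0} (hε : 0 < ε) :
    ∃ d : 𝒳 → ℝ≥0,
      (∀ P' : ProbabilityMeasure 𝒳,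
        channelInfo ch y ζ O P' * ENNReal.ofReal (Real.log 2) ≤ ∫⁻ x, d x ∂P') ∧
      ∫⁻ x, d x ∂P ≤ channelInfo ch y ζ O P * ENNReal.ofReal (Real.log 2) + ε := by
  obtain ⟨Q₀, _, hQ₀⟩ := exists_kernel_forall_klDiv_ne_top ch hy hζ hO
  set Q₁ := condDistrib (fun ω => y ω.2) (fun ω => (ζ ω.1, O ω.2)) ((P : Measure 𝒳) ⊗ₘ ch)
  obtain ⟨a, ha⟩ : ∃ a : ℝ≥0, (a : ℝ) = Real.exp (-ε) := ⟨⟨_, (Real.exp_pos _).le⟩, rfl⟩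
  have ha₀ : a ≠ 0 := NNReal.coe_ne_zero.1 (ha ▸ (Real.exp_pos _).ne')
  have ha₁ : a < 1 := NNReal.coe_lt_coe.1 (by simpa [ha] using hε)
  have : IsMarkovKernel (mixKernel a Q₁ Q₀) := isMarkovKernel_mixKernel ha₁.le _ _
  set D : Kernel (γ × E) α → 𝒳 → ℝ≥0∞ := fun Q x => klDiv (ch.map (fun o => (O o, y o)) x)
    ((ch.map O ⊗ₖ Q.comap (Prod.map ζ id) (hζ.prodMap measurable_id)) x)
  have hfin : ∀ x, D (mixKernel a Q₁ Q₀) x ≠ ∞ := fun x =>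
    ne_top_of_le_ne_top (ENNReal.add_ne_top.2 ⟨hQ₀ x, ENNReal.ofReal_ne_top⟩)
      (klDiv_map_compProd_le_add_log ch hy hO (tsub_pos_of_lt ha₁).ne'
        (fun _ => smul_le_mixKernel_right a Q₁ Q₀ _) x)
  have hle : ∀ x, D (mixKernel a Q₁ Q₀) x ≤ D Q₁ x + ε := fun x => by
    simpa [D, ha] using klDiv_map_compProd_le_add_log ch hy hO ha₀
      (K := Q₁.comap (Prod.map ζ id) (hζ.prodMap measurable_id))
      (fun _ => smul_le_mixKernel_left a Q₁ Q₀ _) x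
  refine ⟨fun x => (D (mixKernel a Q₁ Q₀) x).toNNReal, fun P' => ?_, ?_⟩
  all_goals simp only [ENNReal.coe_toNNReal (hfin _)]
  · have := P'.nonempty
    exact channelInfo_mul_log_le_lintegral ch hy hζ hO P' _
  · rw [channelInfo_mul_log_eq_lintegral ch hy hζ hO]
    refine (lintegral_mono hle).trans ?_
    rw [lintegral_add_right _ measurable_const, lintegral_const, measure_univ, mul_one]

theorem upperSemicontinuous_channelInfo [TopologicalSpace 𝒳] [DiscreteTopology 𝒳]
    [OpensMeasurableSpace 𝒳] :
    UpperSemicontinuous fun P : ProbabilityMeasure 𝒳 => channelInfo ch y ζ O P := by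
  intro P b hb
  have hlog : ENNReal.ofReal (Real.log 2) ≠ 0 := by simpa using Real.log_pos one_lt_two
  have hb' := ENNReal.mul_lt_mul_left hlog ENNReal.ofReal_ne_top hb
  obtain ⟨ε, hε, hPε⟩ := ENNReal.lt_iff_exists_add_pos_lt.1 hb'
  obtain ⟨d, hd, hPd⟩ := exists_forall_channelInfo_mul_log_le ch hy hζ hO P hε
  filter_upwards [(continuous_lintegral_coe d).continuousAt.eventually_lt_const
    (hPd.trans_lt hPε)] with P' hP'
  exact lt_of_mul_lt_mul_right' ((hd P').trans_lt hP')

end Semicontinuity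

section Mask

variable {ι : Type*} [DecidableEq ι] {X : ι → Type*} [∀ i, Nonempty (X i)]

/-- The family `x` with the coordinates outside `S` replaced by constants: it carries the same
information as the subfamily of `x` indexed by `S`, in a type that does not depend on `S`. -/
noncomputable def mask (S : Finset ι) (x : ∀ i, X i) : ∀ i, X i :=
  S.piecewise x (Classical.arbitrary _)

lemma mask_empty (x : ∀ i, X i) : mask ∅ x = Classical.arbitrary _ :=
  Finset.piecewise_empty _ _

lemma mask_insert (j : ι) (S : Finset ι) (x : ∀ i, X i) :
    mask (insert j S) x = Function.update (mask S x) j (x j) :=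
  Finset.piecewise_insert S x _ j

lemma mask_singleton (j : ι) (x : ∀ i, X i) :
    mask {j} x = Function.update (Classical.arbitrary _) j (x j) :=
  Finset.piecewise_singleton x _ j

lemma dependsOn_mask (S : Finset ι) : DependsOn (mask S : (∀ i, X i) → ∀ i, X i) S :=
  fun _ _ h => S.piecewise_congr h fun _ _ => rfl

lemma measurable_mask [∀ i, MeasurableSpace (X i)] (S : Finset ι) :
    Measurable (mask S : (∀ i, X i) → ∀ i, X i) := by
  refine measurable_pi_lambda _ fun i => ?_
  by_cases hi : i ∈ S
  · simpa only [mask, Finset.piecewise_eq_of_mem _ _ _ hi] using measurable_pi_apply i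
  · simpa only [mask, Finset.piecewise_eq_of_notMem _ _ _ hi] using measurable_const

@[fun_prop]
lemma measurable_update_comp {ι Ω : Type*} [DecidableEq ι] {X : ι → Type*}
    [∀ i, MeasurableSpace (X i)] [MeasurableSpace Ω] {x : Ω → ∀ i, X i} (hx : Measurable x)
    {j : ι} {a : Ω → X j} (ha : Measurable a) :
    Measurable fun ω => Function.update (x ω) j (a ω) :=
  measurable_update'.comp (hx.prodMk ha)

end Mask

section MaskedInfo

universe u v

variable {𝒳 : Fin 3 → Type u} {𝒴 : Fin 3 → Type v} [∀ i, MeasurableSpace (𝒳 i)]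
  [∀ i, Nonempty (𝒳 i)] [∀ i, MeasurableSpace (𝒴 i)] [∀ i, StandardBorelSpace (𝒴 i)]
  [∀ i, Nonempty (𝒴 i)] (ch : Kernel (∀ i, 𝒳 i) (∀ i, 𝒴 i)) [IsMarkovKernel ch]

/-- The conditional mutual information `I(Y_j; X | X_D, Y_T)` in bits between the output of user
`j` and the channel input `X` of law `P`. The subfamilies `X_D` and `Y_T` are encoded by `mask`. -/
noncomputable def maskedInfo (j : Fin 3) (D T : Finset (Fin 3)) (P : Measure (∀ i, 𝒳 i))
    [IsFiniteMeasure P] : ℝ≥0∞ :=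
  channelInfo ch (fun y => y j) (mask D) (mask T) P

lemma maskedInfo_eq_condMutualInfo {β γ : Type*} [MeasurableSpace β] [MeasurableSpace γ]
    {j : Fin 3} {D T : Finset (Fin 3)} (P : Measure (∀ i, 𝒳 i)) [IsFiniteMeasure P]
    {X : (∀ i, 𝒳 i) × (∀ i, 𝒴 i) → β} (hX : Measurable X)
    {Z : (∀ i, 𝒳 i) × (∀ i, 𝒴 i) → γ} (hZ : Measurable Z)
    {e : γ → (∀ i, 𝒳 i) × (∀ i, 𝒴 i)} (he : Measurable e)
    {e' : (∀ i, 𝒳 i) × (∀ i, 𝒴 i) → γ} (he' : Measurable e') (hee' : Function.LeftInverse e' e)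
    {f : γ × β → ∀ i, 𝒳 i} (hf : Measurable f)
    {f' : (∀ i, 𝒳 i) → β} (hf' : Measurable f') (hff' : ∀ p, f' (f p) = p.2)
    (hfX : ∀ ω, ω.1 = f (Z ω, X ω)) (heZ : ∀ ω, (mask D ω.1, mask T ω.2) = e (Z ω)) :
    maskedInfo ch j D T P = condMutualInfo (P ⊗ₘ ch) (fun ω => ω.2 j) X Z :=
  condMutualInfo_congr (P ⊗ₘ ch) (by fun_prop) hZ he he' hee' hX hf
    (hf'.comp measurable_snd) hff' hfX heZ

variable {i k : Fin 3} (hik : i ≠ k) (hi : i ≠ 2) (hk : k ≠ 2) (P : Measure (∀ i, 𝒳 i))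
  [IsFiniteMeasure P]
include hik hi hk

omit [∀ i, MeasurableSpace (𝒳 i)] [∀ i, MeasurableSpace (𝒴 i)] [∀ i, StandardBorelSpace (𝒴 i)]
  [∀ i, Nonempty (𝒴 i)] in
lemma eq_update_of_primary (x : ∀ i, 𝒳 i) :
    x = Function.update (Function.update (Function.update (Classical.arbitrary _) k (x k))
      i (x i)) 2 (x 2) := by
  funext l
  obtain rfl | rfl | rfl : l = i ∨ l = k ∨ l = 2 := by omega
  all_goals simp [*, hik.symm]

lemma maskedInfo_primary : maskedInfo ch i {k} ∅ P
    = condMutualInfo (P ⊗ₘ ch) (fun ω => ω.2 i) (fun ω => (ω.1 i, ω.1 2)) (fun ω => ω.1 k) := by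
  refine maskedInfo_eq_condMutualInfo ch P (by fun_prop) (by fun_prop)
    (e := fun a => (Function.update (Classical.arbitrary _) k a, Classical.arbitrary _))
    (by fun_prop) (e' := fun p => p.1 k) (by fun_prop) (fun a => by simp [*])
    (f := fun p => Function.update (Function.update
      (Function.update (Classical.arbitrary _) k p.1) i p.2.1) 2 p.2.2) (by fun_prop)
    (f' := fun x => (x i, x 2)) (by fun_prop) (fun p => by simp [*])
    (fun ω => eq_update_of_primary hik hi hk ω.1) fun ω => ?_
  simp only [mask_singleton, mask_empty]

lemma maskedInfo_primary_of_output : maskedInfo ch k {i} {i} P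
    = condMutualInfo (P ⊗ₘ ch) (fun ω => ω.2 k) (fun ω => (ω.1 k, ω.1 2))
        (fun ω => (ω.1 i, ω.2 i)) := by
  refine maskedInfo_eq_condMutualInfo ch P (by fun_prop) (by fun_prop)
    (e := fun a => (Function.update (Classical.arbitrary _) i a.1,
      Function.update (Classical.arbitrary _) i a.2)) (by fun_prop)
    (e' := fun p => (p.1 i, p.2 i)) (by fun_prop) (fun a => by simp [*])
    (f := fun p => Function.update (Function.update
      (Function.update (Classical.arbitrary _) k p.2.1) i p.1.1) 2 p.2.2) (by fun_prop)
    (f' := fun x => (x k, x 2)) (by fun_prop) (fun p => by simp [*, hik.symm])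
    (fun ω => eq_update_of_primary hik hi hk ω.1) fun ω => ?_
  simp only [mask_singleton]

lemma maskedInfo_cognitive : maskedInfo ch 2 {i, k} ∅ P
    = condMutualInfo (P ⊗ₘ ch) (fun ω => ω.2 2) (fun ω => ω.1 2) (fun ω => (ω.1 i, ω.1 k)) := by
  refine maskedInfo_eq_condMutualInfo ch P (by fun_prop) (by fun_prop)
    (e := fun a => (Function.update (Function.update (Classical.arbitrary _) k a.2) i a.1,
      Classical.arbitrary _)) (by fun_prop)
    (e' := fun p => (p.1 i, p.1 k)) (by fun_prop) (fun a => by simp [*, hik.symm])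
    (f := fun p => Function.update (Function.update
      (Function.update (Classical.arbitrary _) k p.1.2) i p.1.1) 2 p.2) (by fun_prop)
    (f' := fun x => x 2) (by fun_prop) (fun p => by simp [*])
    (fun ω => eq_update_of_primary hik hi hk ω.1) fun ω => ?_
  simp only [mask_insert, mask_singleton, mask_empty]

lemma maskedInfo_cognitive_of_output : maskedInfo ch 2 {i, k} {i} P
    = condMutualInfo (P ⊗ₘ ch) (fun ω => ω.2 2) (fun ω => ω.1 2)
        (fun ω => (ω.1 k, ω.1 i, ω.2 i)) := by
  refine maskedInfo_eq_condMutualInfo ch P (by fun_prop) (by fun_prop)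
    (e := fun a => (Function.update (Function.update (Classical.arbitrary _) k a.1) i a.2.1,
      Function.update (Classical.arbitrary _) i a.2.2)) (by fun_prop)
    (e' := fun p => (p.1 k, p.1 i, p.2 i)) (by fun_prop) (fun a => by simp [*, hik.symm])
    (f := fun p => Function.update (Function.update
      (Function.update (Classical.arbitrary _) k p.1.1) i p.1.2.1) 2 p.2) (by fun_prop)
    (f' := fun x => x 2) (by fun_prop) (fun p => by simp [*])
    (fun ω => eq_update_of_primary hik hi hk ω.1) fun ω => ?_
  simp only [mask_insert, mask_singleton]

lemma maskedInfo_cognitive_of_outputs : maskedInfo ch 2 {i, k} {i, k} P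
    = condMutualInfo (P ⊗ₘ ch) (fun ω => ω.2 2) (fun ω => ω.1 2)
        (fun ω => (ω.1 i, ω.2 i, ω.1 k, ω.2 k)) := by
  refine maskedInfo_eq_condMutualInfo ch P (by fun_prop) (by fun_prop)
    (e := fun a => (Function.update (Function.update (Classical.arbitrary _) k a.2.2.1) i a.1,
      Function.update (Function.update (Classical.arbitrary _) k a.2.2.2) i a.2.1)) (by fun_prop)
    (e' := fun p => (p.1 i, p.2 i, p.1 k, p.2 k)) (by fun_prop) (fun a => by simp [*, hik.symm])
    (f := fun p => Function.update (Function.update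
      (Function.update (Classical.arbitrary _) k p.1.2.2.1) i p.1.1) 2 p.2) (by fun_prop)
    (f' := fun x => x 2) (by fun_prop) (fun p => by simp [*])
    (fun ω => eq_update_of_primary hik hi hk ω.1) fun ω => ?_
  simp only [mask_insert, mask_singleton]

lemma maskedInfo_full (P : Measure (∀ i, 𝒳 i)) [IsProbabilityMeasure P] :
    maskedInfo ch i ∅ ∅ P
      = mutualInfo (P ⊗ₘ ch) (fun ω => ω.2 i) fun ω => (ω.1 i, ω.1 k, ω.1 2) := by
  rw [mutualInfo_eq_condMutualInfo _ (by fun_prop) (by fun_prop)]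
  refine maskedInfo_eq_condMutualInfo ch P (by fun_prop) (by fun_prop)
    (e := fun _ => (Classical.arbitrary _, Classical.arbitrary _)) (by fun_prop)
    (e' := fun _ => ()) (by fun_prop) (fun _ => rfl)
    (f := fun p => Function.update (Function.update
      (Function.update (Classical.arbitrary _) k p.2.2.1) i p.2.1) 2 p.2.2.2) (by fun_prop)
    (f' := fun x => (x i, x k, x 2)) (by fun_prop) (fun p => by simp [*, hik.symm])
    (fun ω => eq_update_of_primary hik hi hk ω.1) fun ω => ?_
  simp only [mask_empty]

omit hik hi hk in
lemma mem_outerRegion_iff (P : ProbabilityMeasure (∀ i, 𝒳 i)) (R : Fin 3 → ℝ) :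
    R ∈ outerRegion ch P ↔ ∀ i k : Fin 3, i ≠ k → i ≠ 2 → k ≠ 2 →
      ENNReal.ofReal (R i) ≤ maskedInfo ch i {k} ∅ P ∧
      ENNReal.ofReal (R 2) ≤ maskedInfo ch 2 {i, k} ∅ P ∧
      ENNReal.ofReal (R i + R 2) ≤ maskedInfo ch i {k} ∅ P + maskedInfo ch 2 {i, k} {i} P ∧
      ENNReal.ofReal (R i + R k + R 2) ≤
        maskedInfo ch i ∅ ∅ P + maskedInfo ch k {i} {i} P + maskedInfo ch 2 {i, k} {i, k} P := by
  have h01 : (0 : Fin 3) ≠ 1 := by decide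
  have h02 : (0 : Fin 3) ≠ 2 := by decide
  have h12 : (1 : Fin 3) ≠ 2 := by decide
  have users (p : Fin 3 → Fin 3 → Prop) :
      (∀ i k, i ≠ k → i ≠ 2 → k ≠ 2 → p i k) ↔ p 0 1 ∧ p 1 0 := by
    simp [Fin.forall_fin_succ]
  rw [users, maskedInfo_primary ch h01 h02 h12, maskedInfo_primary ch h01.symm h12 h02,
    maskedInfo_cognitive_of_output ch h01 h02 h12,
    maskedInfo_cognitive_of_output ch h01.symm h12 h02,
    maskedInfo_full ch h01 h02 h12, maskedInfo_full ch h01.symm h12 h02,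
    maskedInfo_primary_of_output ch h01 h02 h12, maskedInfo_primary_of_output ch h01.symm h12 h02,
    maskedInfo_cognitive_of_outputs ch h01 h02 h12,
    maskedInfo_cognitive_of_outputs ch h01.symm h12 h02,
    Finset.pair_comm 1 0, maskedInfo_cognitive ch h01 h02 h12]
  simp only [outerRegion, Set.mem_ofPred_eq]
  tauto

end MaskedInfo

section BlindChannel

lemma sum_sum_update {ι M : Type*} {X : ι → Type*} [Fintype ι] [DecidableEq ι]
    [∀ i, Fintype (X i)] [AddCommMonoid M] (F : (∀ i, X i) → M) (j : ι) :
    ∑ w, ∑ b, F (Function.update w j b) = Fintype.card (X j) • ∑ w, F w := by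
  have h : ∑ q : (∀ i, X i) × X j, F (Function.update q.1 j q.2)
      = ∑ q : (∀ i, X i) × X j, F q.1 := by
    refine Finset.sum_bij' (fun q _ => (Function.update q.1 j q.2, q.1 j))
      (fun q _ => (Function.update q.1 j q.2, q.1 j)) ?_ ?_ ?_ ?_ ?_ <;> simp
  rw [Fintype.sum_prod_type, Fintype.sum_prod_type] at h
  simp only [h, Finset.sum_const, Finset.card_univ, Finset.smul_sum]

lemma isProbabilityMeasure_blockLaw {𝒳 𝒴 : Fin 3 → Type*} [∀ i, MeasurableSpace (𝒳 i)]
    [∀ i, MeasurableSpace (𝒴 i)] (V : Kernel (∀ i, 𝒳 i) (∀ i, 𝒴 i)) [IsMarkovKernel V] {N : ℕ}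
    (x : Fin N → ∀ i, 𝒳 i) : IsProbabilityMeasure (blockLaw V x) :=
  inferInstanceAs (IsProbabilityMeasure (Measure.pi fun t => V (x t)))

lemma blockLaw_map {𝒳 𝒴 𝒵 : Fin 3 → Type*} [∀ i, MeasurableSpace (𝒳 i)]
    [∀ i, MeasurableSpace (𝒴 i)] [∀ i, MeasurableSpace (𝒵 i)]
    (V : Kernel (∀ i, 𝒳 i) (∀ i, 𝒴 i)) [IsMarkovKernel V] {f : (∀ i, 𝒴 i) → ∀ i, 𝒵 i}
    (hf : Measurable f) {N : ℕ} (x : Fin N → ∀ i, 𝒳 i) :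
    blockLaw (V.map f) x = (blockLaw V x).map fun y t => f (y t) := by
  have (t : Fin N) : IsProbabilityMeasure ((V (x t)).map f) :=
    Measure.isProbabilityMeasure_map hf.aemeasurable
  rw [blockLaw, blockLaw, Measure.pi_map_pi fun t => hf.aemeasurable]
  simp only [Kernel.map_apply _ hf]

universe u v

variable {𝒳 : Fin 3 → Type u} {𝒴 : Fin 3 → Type v} [∀ i, MeasurableSpace (𝒳 i)]
  [∀ i, MeasurableSpace (𝒴 i)] {R : Fin 3 → ℝ} {N : ℕ}

omit [∀ i, MeasurableSpace (𝒳 i)] in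
lemma Code.input_update (c : Code 𝒳 𝒴 R N) (w : Msg N R) {i j : Fin 3} (hij : i ≠ j)
    (hi : i ≠ 2) (b : Fin (numMsg N (R j))) (t : Fin N) :
    c.input (Function.update w j b) t i = c.input w t i := by
  match i with
  | 0 => simp [Code.input, Function.update_of_ne hij]
  | 1 => simp [Code.input, Function.update_of_ne hij]
  | 2 => exact absurd rfl hi

/-- The output blocks from which every user in `T` decodes its component of `w`. -/
def Code.correctSet (c : Code 𝒳 𝒴 R N) (T : Finset (Fin 3)) (w : Msg N R) :
    Set (Fin N → ∀ i, 𝒴 i) :=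
  {y | ∀ i ∈ T, c.dec i (fun t => y t i) = w i}

omit [∀ i, MeasurableSpace (𝒳 i)] in
lemma Code.measurableSet_correctSet (c : Code 𝒳 𝒴 R N) (T : Finset (Fin 3)) (w : Msg N R) :
    MeasurableSet (c.correctSet T w) := by
  rw [Code.correctSet, Set.ofPred_forall]
  refine MeasurableSet.iInter fun i => ?_
  rw [Set.ofPred_forall]
  refine MeasurableSet.iInter fun _ => ?_
  exact ((c.measurable_dec i).comp (by fun_prop)) (measurableSet_singleton (w i))

omit [∀ i, MeasurableSpace (𝒳 i)] in
lemma Code.sum_measure_correctSet_insert (c : Code 𝒳 𝒴 R N) (μ : Measure (Fin N → ∀ i, 𝒴 i))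
    {T : Finset (Fin 3)} {j : Fin 3} (hj : j ∉ T) (w : Msg N R) :
    ∑ b, μ (c.correctSet (insert j T) (Function.update w j b)) = μ (c.correctSet T w) := by
  have hdec : Measurable fun y : Fin N → ∀ i, 𝒴 i => c.dec j fun t => y t j :=
    (c.measurable_dec j).comp (by fun_prop)
  have hset (b) : c.correctSet (insert j T) (Function.update w j b)
      = (fun y : Fin N → ∀ i, 𝒴 i => c.dec j fun t => y t j) ⁻¹' {b} ∩ c.correctSet T w := by
    ext y
    have (i) (hi : i ∈ T) : Function.update w j b i = w i :=
      Function.update_of_ne (ne_of_mem_of_not_mem hi hj) _ _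
    simp +contextual [Code.correctSet, this]
  have h := sum_measure_preimage_singleton (μ := μ.restrict (c.correctSet T w)) Finset.univ
    (f := fun y : Fin N → ∀ i, 𝒴 i => c.dec j fun t => y t j)
    fun b _ => hdec (measurableSet_singleton b)
  simp only [Finset.coe_univ, Set.preimage_univ, Measure.restrict_apply_univ] at h
  rw [← h]
  refine Finset.sum_congr rfl fun b _ => ?_
  rw [hset, Measure.restrict_apply (hdec (measurableSet_singleton b))]

/-- A fictitious channel `V` is blind for the users in `T` if over it every code is decoded
correctly by all of them only as often as by independent uniform guesses. -/
def IsBlind (V : Kernel (∀ i, 𝒳 i) (∀ i, 𝒴 i)) (T : Finset (Fin 3)) : Prop :=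
  ∀ (R : Fin 3 → ℝ) (N : ℕ) (c : Code 𝒳 𝒴 R N),
    (∏ i ∈ T, numMsg N (R i) : ℕ) * ∑ w, blockLaw V (c.input w) (c.correctSet T w)
      = Fintype.card (Msg N R)

lemma isBlind_empty (V : Kernel (∀ i, 𝒳 i) (∀ i, 𝒴 i)) [IsMarkovKernel V] : IsBlind V ∅ := by
  intro R N c
  have (w : Msg N R) : IsProbabilityMeasure (blockLaw V (c.input w)) :=
    isProbabilityMeasure_blockLaw V _
  have huniv (w : Msg N R) : c.correctSet ∅ w = Set.univ := by simp [Code.correctSet]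
  simp only [huniv, measure_univ, Finset.prod_empty, Finset.sum_const, Finset.card_univ]
  simp

variable [∀ i, Nonempty (𝒴 i)]

lemma blockLaw_map_mask_correctSet (V : Kernel (∀ i, 𝒳 i) (∀ i, 𝒴 i)) [IsMarkovKernel V]
    (c : Code 𝒳 𝒴 R N) (T : Finset (Fin 3)) (x : Fin N → ∀ i, 𝒳 i) (w : Msg N R) :
    blockLaw (V.map (mask T)) x (c.correctSet T w) = blockLaw V x (c.correctSet T w) := by
  have hmask := measurable_mask (X := 𝒴) T
  rw [blockLaw_map V hmask, Measure.map_apply (by fun_prop) (c.measurableSet_correctSet T w)]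
  congr 1
  ext y
  simp +contextual [Code.correctSet, mask]

-- The output of user `j` is independent of `W_j`, as primary inputs other than `j`'s ignore `W_j`.
lemma IsBlind.insert_of_map_mask_eq {V V' : Kernel (∀ i, 𝒳 i) (∀ i, 𝒴 i)} [IsMarkovKernel V]
    [IsMarkovKernel V'] {T D : Finset (Fin 3)} (hV : IsBlind V T)
    (hVV' : V'.map (mask T) = V.map (mask T)) (hD : DependsOn (fun x => V' x) D) {j : Fin 3}
    (hjT : j ∉ T) (hjD : j ∉ D) (h2 : 2 ∉ D) :
    IsBlind V' (insert j T) := by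
  intro R N c
  have hblock (w : Msg N R) (b) :
      blockLaw V' (c.input (Function.update w j b)) = blockLaw V' (c.input w) := by
    refine congrArg Measure.pi (funext fun t => hD fun i hi => ?_)
    exact c.input_update w (ne_of_mem_of_not_mem hi hjD) (ne_of_mem_of_not_mem hi h2) b t
  have hsum (w : Msg N R) : ∑ b, blockLaw V' (c.input (Function.update w j b))
      (c.correctSet (insert j T) (Function.update w j b))
        = blockLaw V (c.input w) (c.correctSet T w) := by
    simp only [hblock, c.sum_measure_correctSet_insert _ hjT]
    rw [← blockLaw_map_mask_correctSet, hVV', blockLaw_map_mask_correctSet]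
  have h := sum_sum_update (fun w => blockLaw V' (c.input w) (c.correctSet (insert j T) w)) j
  simp only [hsum, Fintype.card_fin, nsmul_eq_mul] at h
  rw [← hV R N c, h, Finset.prod_insert hjT, mul_comm (numMsg N (R j)), Nat.cast_mul, mul_assoc]

end BlindChannel

section AppendOutput

variable {ι X : Type*} [DecidableEq ι] {Y : ι → Type*} [MeasurableSpace X]
  [∀ i, MeasurableSpace (Y i)] (V : Kernel X (∀ i, Y i)) [IsMarkovKernel V] (j : ι)
  (K : Kernel (X × ∀ i, Y i) (Y j)) [IsMarkovKernel K]

/-- The channel that redraws the output of user `j` of the channel `V` according to `K`, which sees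
the input and the outputs of `V`. -/
noncomputable def appendOutput : Kernel X (∀ i, Y i) :=
  (V ⊗ₖ K).map fun p => Function.update p.1 j p.2

instance : IsMarkovKernel (appendOutput V j K) :=
  Kernel.IsMarkovKernel.map _ (by fun_prop)

lemma appendOutput_map_mask [∀ i, Nonempty (Y i)] {T : Finset ι} (hj : j ∉ T) :
    (appendOutput V j K).map (mask T) = V.map (mask T) := by
  have hmask := measurable_mask (X := Y) T
  have hupdate (p : (∀ i, Y i) × Y j) : mask T (Function.update p.1 j p.2) = mask T p.1 :=
    dependsOn_mask T fun i hi => Function.update_of_ne (ne_of_mem_of_not_mem hi hj) _ _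
  rw [appendOutput, ← Kernel.map_comp_right _ (by fun_prop) hmask]
  conv_rhs => rw [← Kernel.fst_compProd V K, Kernel.fst_eq,
    ← Kernel.map_comp_right _ (by fun_prop) hmask]
  simp only [Function.comp_def, hupdate]

lemma dependsOn_appendOutput {X : ι → Type*} [∀ i, MeasurableSpace (X i)]
    {V : Kernel (∀ i, X i) (∀ i, Y i)} [IsMarkovKernel V]
    {K : Kernel ((∀ i, X i) × ∀ i, Y i) (Y j)} [IsMarkovKernel K] {D : Set ι}
    (hV : DependsOn (fun x => V x) D) (hK : DependsOn (fun x y => K (x, y)) D) :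
    DependsOn (fun x => appendOutput V j K x) D := by
  intro x x' h
  have hVx : V x = V x' := hV h
  have hKx (y) : K (x, y) = K (x', y) := congrFun (hK h) y
  have hVK : (V ⊗ₖ K) x = (V ⊗ₖ K) x' := by
    ext s hs
    simp only [Kernel.compProd_apply hs, hVx, hKx]
  simp only [appendOutput, Kernel.map_apply _ (show Measurable
    fun p : (∀ i, Y i) × Y j => Function.update p.1 j p.2 by fun_prop), hVK]

lemma klDiv_compProd_appendOutput_le [∀ i, Nonempty (Y i)] [StandardBorelSpace (Y j)]
    (P : Measure X) [IsFiniteMeasure P] (ch : Kernel X (∀ i, Y i)) [IsMarkovKernel ch]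
    (T : Finset ι) :
    klDiv (P ⊗ₘ ch.map (mask (insert j T))) (P ⊗ₘ appendOutput V j K)
      ≤ klDiv (P ⊗ₘ ch.map (mask T)) (P ⊗ₘ V)
        + klDiv ((P ⊗ₘ ch).map fun ω => ((ω.1, mask T ω.2), ω.2 j))
            ((P ⊗ₘ ch).map (fun ω => (ω.1, mask T ω.2)) ⊗ₘ K) := by
  have hmask := measurable_mask (X := Y) T
  have hupdate : Measurable fun p : (∀ i, Y i) × Y j => Function.update p.1 j p.2 := by fun_prop
  rw [← klDiv_compProd_append P ch hmask (measurable_pi_apply j)]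
  have hch : ch.map (mask (insert j T))
      = (ch.map fun y => (mask T y, y j)).map fun p => Function.update p.1 j p.2 := by
    rw [← Kernel.map_comp_right _ (by fun_prop) hupdate]
    simp only [Function.comp_def, ← mask_insert]
  rw [hch, appendOutput, Measure.compProd_map hupdate, Measure.compProd_map hupdate]
  exact klDiv_map_le _ _ (by fun_prop)

end AppendOutput

section BlindReference

universe u v

variable {𝒳 : Fin 3 → Type u} {𝒴 : Fin 3 → Type v} [∀ i, MeasurableSpace (𝒳 i)]
  [∀ i, MeasurableSpace (𝒴 i)] [∀ i, Nonempty (𝒴 i)]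

/-- Some channel that ignores the inputs outside `D` and is blind for the users in `T` has
divergence at most `a` bits from `ch` at the outputs of `T`, under the input law `P`. -/
def HasBlindReference (ch : Kernel (∀ i, 𝒳 i) (∀ i, 𝒴 i)) (P : Measure (∀ i, 𝒳 i))
    (T D : Finset (Fin 3)) (a : ℝ≥0∞) : Prop :=
  ∃ V : Kernel (∀ i, 𝒳 i) (∀ i, 𝒴 i), IsMarkovKernel V ∧ IsBlind V T ∧
    DependsOn (fun x => V x) D ∧
    klDiv (P ⊗ₘ ch.map (mask T)) (P ⊗ₘ V) ≤ a * ENNReal.ofReal (Real.log 2)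

variable (ch : Kernel (∀ i, 𝒳 i) (∀ i, 𝒴 i)) [IsMarkovKernel ch] (P : Measure (∀ i, 𝒳 i))
  [IsFiniteMeasure P]

lemma hasBlindReference_empty : HasBlindReference ch P ∅ ∅ 0 := by
  have hmask : ch.map (mask ∅) = Kernel.const _ (Measure.dirac (Classical.arbitrary _)) := by
    ext1 x
    rw [Kernel.map_apply _ (measurable_mask ∅), funext mask_empty, Measure.map_const,
      measure_univ, one_smul, Kernel.const_apply]
  refine ⟨Kernel.const _ (Measure.dirac (Classical.arbitrary _)), inferInstance, isBlind_empty _,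
    fun _ _ _ => rfl, ?_⟩
  rw [hmask, klDiv_self]
  exact zero_le

variable {ch P}

lemma HasBlindReference.insert_user [∀ i, Nonempty (𝒳 i)] [∀ i, StandardBorelSpace (𝒴 i)]
    {T D D' : Finset (Fin 3)} {a : ℝ≥0∞} (h : HasBlindReference ch P T D a) {j : Fin 3}
    (hDD' : D ⊆ D') (hjT : j ∉ T) (hjD : j ∉ D') (h2 : 2 ∉ D') :
    HasBlindReference ch P (insert j T) D' (a + maskedInfo ch j D' T P) := by
  obtain ⟨V, hVm, hVT, hVD, hVP⟩ := h
  have hin := measurable_mask (X := 𝒳) D'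
  have hout := measurable_mask (X := 𝒴) T
  set K := (condDistrib (fun ω : (∀ i, 𝒳 i) × (∀ i, 𝒴 i) => ω.2 j)
    (fun ω => (mask D' ω.1, mask T ω.2)) (P ⊗ₘ ch)).comap (Prod.map (mask D') id)
      (hin.prodMap measurable_id) with hK
  have hdep : DependsOn (fun x => appendOutput V j K x) (D' : Set (Fin 3)) := by
    refine dependsOn_appendOutput j (hVD.mono (Finset.coe_subset.2 hDD')) fun x x' hx => ?_
    simp only [hK, Kernel.comap_apply, Prod.map_apply, dependsOn_mask D' hx]
  refine ⟨appendOutput V j K, inferInstance,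
    hVT.insert_of_map_mask_eq (appendOutput_map_mask V j K hjT) hdep hjT hjD h2, hdep, ?_⟩
  refine (klDiv_compProd_appendOutput_le V j K P ch T).trans ?_
  rw [add_mul, maskedInfo, channelInfo_mul_log_eq_klDiv ch (measurable_pi_apply j) hin hout]
  exact add_le_add hVP le_rfl

end BlindReference

section MessageCount

lemma numMsg_pos {N : ℕ} {r : ℝ} (hr : 0 ≤ r) : 0 < numMsg N r := by
  rw [numMsg, Nat.floor_pos]
  exact Real.one_le_rpow one_le_two (by positivity)

lemma nonempty_msg {R : Fin 3 → ℝ} (hR : ∀ i, 0 ≤ R i) (N : ℕ) : Nonempty (Msg N R) :=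
  ⟨fun i => ⟨0, numMsg_pos (hR i)⟩⟩

lemma log_numMsg_le {N : ℕ} {r : ℝ} (hr : 0 ≤ r) :
    Real.log (numMsg N r) ≤ N * r * Real.log 2 := by
  rw [← Real.log_rpow two_pos]
  exact Real.log_le_log (by exact_mod_cast numMsg_pos hr) (Nat.floor_le (by positivity))

lemma le_log_numMsg {N : ℕ} {r : ℝ} (hr : 0 ≤ r) :
    (N * r - 1) * Real.log 2 ≤ Real.log (numMsg N r) := by
  have h1 : (1 : ℝ) ≤ numMsg N r := by exact_mod_cast numMsg_pos hr
  have h2 : (2 : ℝ) ^ (N * r) < numMsg N r + 1 := Nat.lt_floor_add_one _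
  rw [← Real.log_rpow two_pos, Real.rpow_sub two_pos, Real.rpow_one]
  exact Real.log_le_log (by positivity) (by linarith)

variable {R : Fin 3 → ℝ} (hR : ∀ i, 0 ≤ R i) (N : ℕ) (T : Finset (Fin 3))
include hR

lemma log_prod_numMsg :
    Real.log (∏ i ∈ T, numMsg N (R i) : ℕ) = ∑ i ∈ T, Real.log (numMsg N (R i)) := by
  rw [Nat.cast_prod, Real.log_prod fun i _ => (Nat.cast_pos.2 (numMsg_pos (hR i))).ne']

lemma log_prod_numMsg_le :
    Real.log (∏ i ∈ T, numMsg N (R i) : ℕ) ≤ N * (∑ i, R i) * Real.log 2 := by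
  rw [log_prod_numMsg hR, Finset.mul_sum, Finset.sum_mul]
  exact (Finset.sum_le_sum fun i _ => log_numMsg_le (hR i)).trans
    (Finset.sum_le_sum_of_subset_of_nonneg (Finset.subset_univ _)
      fun i _ _ => by have := hR i; positivity)

lemma le_log_prod_numMsg :
    (N * (∑ i ∈ T, R i) - 3) * Real.log 2 ≤ Real.log (∏ i ∈ T, numMsg N (R i) : ℕ) := by
  have hcard : (T.card : ℝ) ≤ 3 := by exact_mod_cast Finset.card_le_univ T
  calc (N * (∑ i ∈ T, R i) - 3) * Real.log 2
      ≤ (N * (∑ i ∈ T, R i) - T.card) * Real.log 2 := by gcongr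
    _ = ∑ i ∈ T, (N * R i - 1) * Real.log 2 := by
        rw [← Finset.sum_mul, Finset.sum_sub_distrib, ← Finset.mul_sum]
        simp
    _ ≤ Real.log (∏ i ∈ T, numMsg N (R i) : ℕ) := by
        rw [log_prod_numMsg hR]
        exact Finset.sum_le_sum fun i _ => le_log_numMsg (hR i)

end MessageCount

section CodeConverse

universe u v

variable {𝒳 : Fin 3 → Type u} {𝒴 : Fin 3 → Type v} [∀ i, MeasurableSpace (𝒳 i)]
  [∀ i, MeasurableSpace (𝒴 i)] {R : Fin 3 → ℝ} {N : ℕ}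

/-- The law of the channel input at a uniformly chosen time, for uniform messages. -/
noncomputable def Code.inputLaw (c : Code 𝒳 𝒴 R N) : Measure (∀ i, 𝒳 i) :=
  (Fintype.card (Msg N R × Fin N) : ℝ≥0∞)⁻¹ •
    ∑ q : Msg N R × Fin N, Measure.dirac (c.input q.1 q.2)

lemma Code.isProbabilityMeasure_inputLaw (c : Code 𝒳 𝒴 R N) (hR : ∀ i, 0 ≤ R i) (hN : 0 < N) :
    IsProbabilityMeasure c.inputLaw := by
  have := nonempty_msg hR N
  have : Nonempty (Fin N) := ⟨⟨0, hN⟩⟩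
  refine ⟨?_⟩
  simp only [Code.inputLaw, Measure.smul_apply, Measure.coe_finsetSum, Finset.sum_apply,
    measure_univ, smul_eq_mul, Finset.sum_const, Finset.card_univ, nsmul_eq_mul, mul_one]
  exact ENNReal.inv_mul_cancel (Nat.cast_ne_zero.2 Fintype.card_ne_zero) (ENNReal.natCast_ne_top _)

lemma Code.klDiv_inputLaw_compProd [∀ i, StandardBorelSpace (𝒴 i)] (c : Code 𝒳 𝒴 R N)
    [IsFiniteMeasure c.inputLaw] (κ V : Kernel (∀ i, 𝒳 i) (∀ i, 𝒴 i)) [IsMarkovKernel κ]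
    [IsMarkovKernel V] :
    klDiv (c.inputLaw ⊗ₘ κ) (c.inputLaw ⊗ₘ V) = (Fintype.card (Msg N R) * N : ℝ≥0∞)⁻¹ *
      ∑ w, klDiv (blockLaw κ (c.input w)) (blockLaw V (c.input w)) := by
  rw [klDiv_compProd_eq_lintegral]
  simp only [Code.inputLaw, lintegral_smul_measure, smul_eq_mul, lintegral_finsetSum_measure,
    lintegral_dirac' _ (measurable_klDiv_kernel κ V),
    Fintype.sum_prod_type, blockLaw, klDiv_pi, Fintype.card_prod, Fintype.card_fin, Nat.cast_mul]

section Error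

variable (ch : Kernel (∀ i, 𝒳 i) (∀ i, 𝒴 i)) (c : Code 𝒳 𝒴 R N)

lemma Code.errorProb_nonneg (i : Fin 3) : 0 ≤ c.errorProb ch i :=
  div_nonneg (Finset.sum_nonneg fun _ _ => measureReal_nonneg) (Nat.cast_nonneg _)

lemma Code.card_mul_errorProb (hR : ∀ i, 0 ≤ R i) (i : Fin 3) :
    Fintype.card (Msg N R) * c.errorProb ch i
      = ∑ w, (blockLaw ch (c.input w)).real {y | c.dec i (fun t => y t i) ≠ w i} := by
  have := nonempty_msg hR N
  exact mul_div_cancel₀ _ (Nat.cast_ne_zero.2 Fintype.card_ne_zero)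

lemma Code.one_sub_sum_le_measureReal_correctSet [IsMarkovKernel ch] (T : Finset (Fin 3))
    (w : Msg N R) :
    1 - ∑ i ∈ T, (blockLaw ch (c.input w)).real {y | c.dec i (fun t => y t i) ≠ w i}
      ≤ (blockLaw ch (c.input w)).real (c.correctSet T w) := by
  have := isProbabilityMeasure_blockLaw ch (c.input w)
  have hcompl : (c.correctSet T w)ᶜ = ⋃ i ∈ T, {y | c.dec i (fun t => y t i) ≠ w i} := by
    ext y
    simp [Code.correctSet]
  have hunion := measureReal_biUnion_finset_le (μ := blockLaw ch (c.input w)) T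
    fun i => {y | c.dec i (fun t => y t i) ≠ w i}
  rw [← hcompl, probReal_compl_eq_one_sub (c.measurableSet_correctSet T w)] at hunion
  linarith

lemma Code.card_mul_one_sub_sum_errorProb_le [IsMarkovKernel ch] (hR : ∀ i, 0 ≤ R i)
    (T : Finset (Fin 3)) :
    Fintype.card (Msg N R) * (1 - ∑ i ∈ T, c.errorProb ch i)
      ≤ ∑ w, (blockLaw ch (c.input w)).real (c.correctSet T w) := by
  refine le_trans (le_of_eq ?_) (Finset.sum_le_sum fun w _ =>
    c.one_sub_sum_le_measureReal_correctSet ch T w)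
  rw [Finset.sum_sub_distrib, Finset.sum_comm, mul_sub, Finset.mul_sum]
  simp only [c.card_mul_errorProb ch hR, Finset.sum_const, Finset.card_univ, nsmul_eq_mul]

end Error

lemma IsBlind.prod_numMsg_mul_sum_measureReal {V : Kernel (∀ i, 𝒳 i) (∀ i, 𝒴 i)}
    [IsMarkovKernel V] {T : Finset (Fin 3)} (hV : IsBlind V T) (c : Code 𝒳 𝒴 R N) :
    (∏ i ∈ T, numMsg N (R i) : ℕ) * ∑ w, (blockLaw V (c.input w)).real (c.correctSet T w)
      = Fintype.card (Msg N R) := by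
  have (w : Msg N R) := isProbabilityMeasure_blockLaw V (c.input w)
  have h := congrArg ENNReal.toReal (hV R N c)
  rwa [ENNReal.toReal_mul, ENNReal.toReal_sum fun w _ => measure_ne_top _ _,
    ENNReal.toReal_natCast, ENNReal.toReal_natCast] at h

variable [∀ i, Nonempty (𝒴 i)]

-- The binary form of data processing for the event of correct decoding, with `exp s` the number of
-- messages, whose probability averages to `exp (-s)` over a blind channel.
lemma IsBlind.ofReal_le_sum_klDiv {V : Kernel (∀ i, 𝒳 i) (∀ i, 𝒴 i)} [IsMarkovKernel V]
    {T : Finset (Fin 3)} (hV : IsBlind V T) (ch : Kernel (∀ i, 𝒳 i) (∀ i, 𝒴 i))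
    [IsMarkovKernel ch] (hR : ∀ i, 0 ≤ R i) (c : Code 𝒳 𝒴 R N) :
    ENNReal.ofReal (Fintype.card (Msg N R) * (Real.log (∏ i ∈ T, numMsg N (R i) : ℕ)
        * (1 - ∑ i ∈ T, c.errorProb ch i) - 1))
      ≤ ∑ w, klDiv (blockLaw (ch.map (mask T)) (c.input w)) (blockLaw V (c.input w)) := by
  have : IsMarkovKernel (ch.map (mask T)) := Kernel.IsMarkovKernel.map _ (measurable_mask T)
  have (w : Msg N R) := isProbabilityMeasure_blockLaw (ch.map (mask T)) (c.input w)
  have (w : Msg N R) := isProbabilityMeasure_blockLaw V (c.input w)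
  have hpos : 0 < ∏ i ∈ T, numMsg N (R i) := Finset.prod_pos fun i _ => numMsg_pos (hR i)
  set s := Real.log (∏ i ∈ T, numMsg N (R i) : ℕ)
  have hexp : Real.exp s = (∏ i ∈ T, numMsg N (R i) : ℕ) := Real.exp_log (Nat.cast_pos.2 hpos)
  set α : Msg N R → ℝ := fun w => (blockLaw (ch.map (mask T)) (c.input w)).real (c.correctSet T w)
  set β : Msg N R → ℝ := fun w => (blockLaw V (c.input w)).real (c.correctSet T w)
  have hα : Fintype.card (Msg N R) * (1 - ∑ i ∈ T, c.errorProb ch i) ≤ ∑ w, α w := by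
    simpa only [α, measureReal_def, blockLaw_map_mask_correctSet]
      using c.card_mul_one_sub_sum_errorProb_le ch hR T
  have hβ : Real.exp s * ∑ w, β w = Fintype.card (Msg N R) :=
    hexp ▸ hV.prod_numMsg_mul_sum_measureReal c
  have hβ0 : 0 ≤ ∑ w, β w := Finset.sum_nonneg fun _ _ => measureReal_nonneg
  have hs0 : 0 ≤ s := Real.log_natCast_nonneg _
  calc _ ≤ ENNReal.ofReal (∑ w, (s * α w - (Real.exp s - 1) * β w)) := by
        refine ENNReal.ofReal_le_ofReal ?_
        rw [Finset.sum_sub_distrib, ← Finset.mul_sum, ← Finset.mul_sum, sub_mul, hβ]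
        linarith [mul_le_mul_of_nonneg_left hα hs0]
    _ ≤ ∑ w, ENNReal.ofReal (s * α w - (Real.exp s - 1) * β w) :=
        Finset.le_sum_of_subadditive _ ENNReal.ofReal_zero.le (fun _ _ => ENNReal.ofReal_add_le) _ _
    _ ≤ _ := Finset.sum_le_sum fun w _ => ofReal_measureReal_le_klDiv _ _ _ s

/-- The loss in the rate bounds for a code of block length `N`. -/
noncomputable def Code.slack (ch : Kernel (∀ i, 𝒳 i) (∀ i, 𝒴 i)) (c : Code 𝒳 𝒴 R N) : ℝ :=
  5 / N + (∑ i, R i) * ∑ i, c.errorProb ch i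

variable (ch : Kernel (∀ i, 𝒳 i) (∀ i, 𝒴 i)) (c : Code 𝒳 𝒴 R N)

omit [∀ i, Nonempty (𝒴 i)] in
lemma Code.slack_nonneg (hR : ∀ i, 0 ≤ R i) : 0 ≤ c.slack ch :=
  add_nonneg (by positivity) (mul_nonneg (Finset.sum_nonneg fun i _ => hR i)
    (Finset.sum_nonneg fun i _ => c.errorProb_nonneg ch i))

omit [∀ i, Nonempty (𝒴 i)] in
lemma Code.mul_sub_slack_le (hR : ∀ i, 0 ≤ R i) (hN : 0 < N) (T : Finset (Fin 3)) :
    N * ((∑ i ∈ T, R i - c.slack ch) * Real.log 2)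
      ≤ Real.log (∏ i ∈ T, numMsg N (R i) : ℕ) * (1 - ∑ i ∈ T, c.errorProb ch i) - 1 := by
  have hN0 : (N : ℝ) ≠ 0 := Nat.cast_ne_zero.2 hN.ne'
  have herr : ∑ i ∈ T, c.errorProb ch i ≤ ∑ i, c.errorProb ch i :=
    Finset.sum_le_sum_of_subset_of_nonneg (Finset.subset_univ T)
      fun i _ _ => c.errorProb_nonneg ch i
  have hloss : Real.log (∏ i ∈ T, numMsg N (R i) : ℕ) * ∑ i ∈ T, c.errorProb ch i
      ≤ N * (∑ i, R i) * Real.log 2 * ∑ i, c.errorProb ch i :=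
    mul_le_mul (log_prod_numMsg_le hR N T) herr
      (Finset.sum_nonneg fun i _ => c.errorProb_nonneg ch i)
      (by have := Finset.sum_nonneg fun i (_ : i ∈ Finset.univ) => hR i; positivity)
  have hslack : N * c.slack ch = 5 + N * (∑ i, R i) * ∑ i, c.errorProb ch i := by
    rw [Code.slack]
    field_simp
  linear_combination le_log_prod_numMsg hR N T + hloss - Real.log 2 * hslack
    + 2 * Real.log_two_gt_d9.le

variable [∀ i, StandardBorelSpace (𝒴 i)] [IsMarkovKernel ch]

lemma HasBlindReference.ofReal_sub_slack_le {ch : Kernel (∀ i, 𝒳 i) (∀ i, 𝒴 i)}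
    [IsMarkovKernel ch] {c : Code 𝒳 𝒴 R N} {T D : Finset (Fin 3)} {a : ℝ≥0∞}
    (h : HasBlindReference ch c.inputLaw T D a) (hR : ∀ i, 0 ≤ R i) (hN : 0 < N) :
    ENNReal.ofReal (∑ i ∈ T, R i - c.slack ch) ≤ a := by
  obtain ⟨V, hVm, hVT, -, hVP⟩ := h
  have := c.isProbabilityMeasure_inputLaw hR hN
  have : IsMarkovKernel (ch.map (mask T)) := Kernel.IsMarkovKernel.map _ (measurable_mask T)
  have := nonempty_msg hR N
  have hlog : 0 < Real.log 2 := Real.log_pos one_lt_two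
  have hcard : (Fintype.card (Msg N R) * N : ℝ≥0∞) ≠ 0 :=
    mul_ne_zero (Nat.cast_ne_zero.2 Fintype.card_ne_zero) (Nat.cast_ne_zero.2 hN.ne')
  have hcard' : (Fintype.card (Msg N R) * N : ℝ≥0∞) ≠ ∞ :=
    ENNReal.mul_ne_top (ENNReal.natCast_ne_top _) (ENNReal.natCast_ne_top _)
  rw [c.klDiv_inputLaw_compProd, ENNReal.inv_mul_le_iff hcard hcard'] at hVP
  have hbound := (ENNReal.ofReal_le_ofReal (mul_le_mul_of_nonneg_left
    (c.mul_sub_slack_le ch hR hN T) (Nat.cast_nonneg _))).trans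
      ((hVT.ofReal_le_sum_klDiv ch hR c).trans hVP)
  rwa [← mul_assoc, ENNReal.ofReal_mul (by positivity), ENNReal.ofReal_mul (by positivity),
    ENNReal.ofReal_natCast, ENNReal.ofReal_natCast, ENNReal.ofReal_mul' hlog.le,
    ENNReal.mul_le_mul_iff_right hcard hcard', ENNReal.mul_le_mul_iff_left
      (ENNReal.ofReal_pos.2 hlog).ne' ENNReal.ofReal_ne_top] at hbound

end CodeConverse

section Region

universe u v

variable {𝒳 : Fin 3 → Type u} {𝒴 : Fin 3 → Type v} [∀ i, MeasurableSpace (𝒳 i)]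
  [∀ i, MeasurableSpace (𝒴 i)] {R : Fin 3 → ℝ} {N : ℕ} (ch : Kernel (∀ i, 𝒳 i) (∀ i, 𝒴 i))

omit [∀ i, MeasurableSpace (𝒳 i)] in
lemma Code.nonempty_input (c : Code 𝒳 𝒴 R N) (hR : ∀ i, 0 ≤ R i) (hN : 0 < N) (i : Fin 3) :
    Nonempty (𝒳 i) :=
  (nonempty_msg hR N).map fun w => c.input w ⟨0, hN⟩ i

lemma tendsto_slack (c : ∀ N, Code 𝒳 𝒴 R N)
    (hc : Tendsto (fun N => ⨆ i, (c N).errorProb ch i) atTop (𝓝 0)) :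
    Tendsto (fun N => (c N).slack ch) atTop (𝓝 0) := by
  have herr (i) : Tendsto (fun N => (c N).errorProb ch i) atTop (𝓝 0) :=
    squeeze_zero (fun N => (c N).errorProb_nonneg ch i)
      (fun N => le_ciSup (f := fun i => (c N).errorProb ch i) (Set.finite_range _).bddAbove i) hc
  have hlength : Tendsto (fun N : ℕ => (5 : ℝ) / N) atTop (𝓝 0) :=
    tendsto_const_nhds.div_atTop tendsto_natCast_atTop_atTop
  have hsum := (tendsto_finsetSum Finset.univ fun i _ => herr i).const_mul (∑ i, R i)
  simpa [Code.slack] using hlength.add hsum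

variable [∀ i, StandardBorelSpace (𝒴 i)] [∀ i, Nonempty (𝒴 i)] [IsMarkovKernel ch]

lemma Code.sub_slack_mem_outerRegion (hR : ∀ i, 0 ≤ R i) (hN : 0 < N) (c : Code 𝒳 𝒴 R N) :
    (fun i => R i - c.slack ch)
      ∈ outerRegion ch ⟨c.inputLaw, c.isProbabilityMeasure_inputLaw hR hN⟩ := by
  have := c.isProbabilityMeasure_inputLaw hR hN
  have := c.nonempty_input hR hN
  have hslack := c.slack_nonneg ch hR
  have bound {T D : Finset (Fin 3)} {r : ℝ} {a : ℝ≥0∞} (h : HasBlindReference ch c.inputLaw T D a)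
      (hr : r ≤ ∑ i ∈ T, R i - c.slack ch) : ENNReal.ofReal r ≤ a :=
    (ENNReal.ofReal_le_ofReal hr).trans (h.ofReal_sub_slack_le hR hN)
  refine (mem_outerRegion_iff ch _ _).2 fun i k hik hi hk => ?_
  have primary := (hasBlindReference_empty ch c.inputLaw).insert_user (j := i) (D' := {k})
    (by simp) (by simp) (by simpa) (by simpa using hk.symm)
  have cognitive := (hasBlindReference_empty ch c.inputLaw).insert_user (j := 2) (D' := {i, k})
    (by simp) (by simp) (by simp [hi.symm, hk.symm]) (by simp [hi.symm, hk.symm])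
  have pair := primary.insert_user (j := 2) (D' := {i, k})
    (by simp) (by simp [hi.symm]) (by simp [hi.symm, hk.symm]) (by simp [hi.symm, hk.symm])
  have full := (((hasBlindReference_empty ch c.inputLaw).insert_user (j := i) (D' := ∅)
    (by simp) (by simp) (by simp) (by simp)).insert_user (j := k) (D' := {i})
    (by simp) (by simpa using hik.symm) (by simpa using hik.symm)
    (by simpa using hi.symm)).insert_user (j := 2) (D' := {i, k})
    (by simp) (by simp [hi.symm, hk.symm]) (by simp [hi.symm, hk.symm])
    (by simp [hi.symm, hk.symm])
  simp only [insert_empty_eq, zero_add, Finset.pair_comm k i] at primary cognitive pair full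
  refine ⟨bound primary ?_, bound cognitive ?_, bound pair ?_, bound full ?_⟩
  · simp
  · simp
  · rw [Finset.sum_pair hi.symm]
    linarith
  · rw [Finset.sum_insert (by simp [hi.symm, hk.symm]), Finset.sum_pair hik]
    linarith

lemma capacityRegion_subset_closure :
    capacityRegion ch ⊆ closure (⋃ P : ProbabilityMeasure (∀ i, 𝒳 i), outerRegion ch P) := by
  rintro R ⟨hR, c, hc⟩
  refine mem_closure_of_tendsto (f := fun N i => R i - (c N).slack ch) (b := atTop) ?_ ?_
  · refine tendsto_pi_nhds.2 fun i => ?_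
    simpa using (tendsto_slack ch c hc).const_sub (R i)
  · filter_upwards [eventually_gt_atTop 0] with N hN
    exact Set.mem_iUnion.2 ⟨_, (c N).sub_slack_mem_outerRegion ch hR hN⟩

section Finite

variable [∀ i, Finite (𝒳 i)]

lemma upperSemicontinuous_maskedInfo [TopologicalSpace (∀ i, 𝒳 i)] [DiscreteTopology (∀ i, 𝒳 i)]
    [OpensMeasurableSpace (∀ i, 𝒳 i)] [∀ i, Nonempty (𝒳 i)] (j : Fin 3) (D T : Finset (Fin 3)) :
    UpperSemicontinuous fun P : ProbabilityMeasure (∀ i, 𝒳 i) => maskedInfo ch j D T P :=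
  upperSemicontinuous_channelInfo ch (measurable_pi_apply j) (measurable_mask D)
    (measurable_mask T)

lemma isClosed_setOf_mem_outerRegion [TopologicalSpace (∀ i, 𝒳 i)] [DiscreteTopology (∀ i, 𝒳 i)]
    [OpensMeasurableSpace (∀ i, 𝒳 i)] [∀ i, Nonempty (𝒳 i)] :
    IsClosed {q : (Fin 3 → ℝ) × ProbabilityMeasure (∀ i, 𝒳 i) | q.1 ∈ outerRegion ch q.2} := by
  have hclosed {r : (Fin 3 → ℝ) → ℝ} (hr : Continuous r)
      {f : ProbabilityMeasure (∀ i, 𝒳 i) → ℝ≥0∞} (hf : UpperSemicontinuous f) :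
      IsClosed {q : (Fin 3 → ℝ) × ProbabilityMeasure (∀ i, 𝒳 i) | ENNReal.ofReal (r q.1) ≤ f q.2} :=
    hf.IsClosed_hypograph.preimage (continuous_snd.prodMk
      (ENNReal.continuous_ofReal.comp (hr.comp continuous_fst)))
  have husc := upperSemicontinuous_maskedInfo ch
  simp only [mem_outerRegion_iff, Set.ofPred_forall, Set.ofPred_and]
  refine isClosed_iInter fun i => isClosed_iInter fun k => isClosed_iInter fun _ =>
    isClosed_iInter fun _ => isClosed_iInter fun _ => ?_
  exact (hclosed (r := fun R => R i) (by fun_prop) (husc i {k} ∅)).inter <|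
    (hclosed (r := fun R => R 2) (by fun_prop) (husc 2 {i, k} ∅)).inter <|
    (hclosed (r := fun R => R i + R 2) (by fun_prop)
      ((husc i {k} ∅).add (husc 2 {i, k} {i}))).inter <|
    hclosed (r := fun R => R i + R k + R 2) (by fun_prop)
      (((husc i ∅ ∅).add (husc k {i} {i})).add (husc 2 {i, k} {i, k}))

variable [∀ i, MeasurableSingletonClass (𝒳 i)]

lemma isClosed_iUnion_outerRegion [∀ i, Nonempty (𝒳 i)] :
    IsClosed (⋃ P : ProbabilityMeasure (∀ i, 𝒳 i), outerRegion ch P) := by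
  let : TopologicalSpace (∀ i, 𝒳 i) := ⊥
  have : DiscreteTopology (∀ i, 𝒳 i) := ⟨rfl⟩
  have : BorelSpace (∀ i, 𝒳 i) := inferInstance
  have h := isClosedMap_fst_of_compactSpace _ (isClosed_setOf_mem_outerRegion ch)
  convert h using 1
  ext R
  simp

lemma capacityRegion_subset_iUnion :
    capacityRegion ch ⊆ ⋃ P : ProbabilityMeasure (∀ i, 𝒳 i), outerRegion ch P := by
  intro R hR
  obtain ⟨hR0, c, -⟩ := id hR
  have := (c 1).nonempty_input hR0 one_pos
  exact (isClosed_iUnion_outerRegion ch).closure_eq ▸ capacityRegion_subset_closure ch hR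

end Finite

end Region

end CIFC

theorem mainTheorem1_general {𝒳 : Fin 3 → Type*} {𝒴 : Fin 3 → Type*}
    [∀ i, MeasurableSpace (𝒳 i)]
    [∀ i, MeasurableSpace (𝒴 i)] [∀ i, StandardBorelSpace (𝒴 i)] [∀ i, Nonempty (𝒴 i)]
    (ch : Kernel (∀ i, 𝒳 i) (∀ i, 𝒴 i)) [IsMarkovKernel ch] :
    CIFC.capacityRegion ch ⊆
        closure (⋃ P : ProbabilityMeasure (∀ i, 𝒳 i), CIFC.outerRegion ch P) ∧
      ((∀ i, Finite (𝒳 i)) → (∀ i, MeasurableSingletonClass (𝒳 i)) → CIFC.capacityRegion ch ⊆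
        ⋃ P : ProbabilityMeasure (∀ i, 𝒳 i), CIFC.outerRegion ch P) :=
  ⟨CIFC.capacityRegion_subset_closure ch, fun _ _ => CIFC.capacityRegion_subset_iUnion ch⟩

theorem mainTheorem1 {𝒳 : Fin 3 → Type*} {𝒴 : Fin 3 → Type*}
    [∀ i, MeasurableSpace (𝒳 i)] [∀ i, StandardBorelSpace (𝒳 i)]
    [∀ i, MeasurableSpace (𝒴 i)] [∀ i, StandardBorelSpace (𝒴 i)] [∀ i, Nonempty (𝒴 i)]
    (ch : Kernel (∀ i, 𝒳 i) (∀ i, 𝒴 i)) [IsMarkovKernel ch] :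
    CIFC.capacityRegion ch ⊆
        closure (⋃ P : ProbabilityMeasure (∀ i, 𝒳 i), CIFC.outerRegion ch P) ∧
      ((∀ i, Finite (𝒳 i)) → CIFC.capacityRegion ch ⊆
        ⋃ P : ProbabilityMeasure (∀ i, 𝒳 i), CIFC.outerRegion ch P) :=
  (mainTheorem1_general ch).imp_right fun h hfin => h hfin inferInstance
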